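/- Consider quarter plane walks with steps N $=(0,1)$, E $=(1,0)$ and SW $=(-1,-1)$, that is, walks that start at $(0,0)$, use only these steps, and visit only points with nonnegative coordinates. Let $q(i,j;n)$ be the number of such walks of length $n$ that end at $(i,j)$, and let $$Q(x,y;t)=\sum_{i,j,n\ge 0} q(i,j;n)\,x^iy^jt^n,\qquad Q_d(x;t)=\sum_{i,n\ge 0} q(i,i;n)\,x^i t^n .$$ There is a unique power series $W\equiv W(t)\in\mathbb{Q}[[t]]$ such that $W=t(2+W^3)$. For a power series $F$ in $t$ with coefficients in $\mathbb{Q}[x]$ and constant term $1$, let $\sqrt F$ be its square root with constant term $1$. Then the generating function of the walks that end on the $x$-axis is (in the field $\mathbb{Q}(x)((t))$) $$Q(x,0;t)=\frac{W(4-W^3)}{16t}-\frac{t-x^2+tx^3}{2xt^2}-\frac{(2x^2-xW^2-W)\sqrt{1-xW(W^3+4)/4+x^2W^2/4}}{2txW},$$ and the generating function of the walks that end on the diagonal is $$Q_d(x;t)=\frac{xW(x+W)-2}{2tx^2\sqrt{1-xW^2}}+\frac1{tx^2}.$$ For every $i\ge 0$, the length generating function of the walks that end at $(i,i)$ is $$[x^i]Q_d(x;t)=\frac{W^{2i+1}}{4^{i+1}\,t\,(i+2)}\binom{2i}{i}\left(2i+4-(2i+1)W^3\right).$$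 For all $i,m\ge 0$, the number of walks of length $n=3m+2i$ that end at $(i,i)$ is $$q(i,i;3m+2i)=\frac{4^m(i+1)^2}{(m+i+1)(2m+2i+1)}\binom{2i+1}{i}\binom{3m+2i}{m}.$$ -/

import Mathlib

noncomputable section

namespace ReverseKreweras

open Polynomial

/-- The three steps N, E and SW. -/
def steps : Finset (ℤ × ℤ) := {(0, 1), (1, 0), (-1, -1)}

/-- A list of steps is a quarter plane walk (starting at the origin) when all its steps are
N, E or SW, and every point it visits has nonnegative coordinates. -/
def IsQuadrantWalk (w : List (ℤ × ℤ)) : Prop :=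
  (∀ s ∈ w, s ∈ steps) ∧ ∀ k ≤ w.length, 0 ≤ (w.take k).sum.1 ∧ 0 ≤ (w.take k).sum.2

/-- The quarter plane walks of length `n` that end at `(i, j)`. -/
def walks (i j n : ℕ) : Set (List (ℤ × ℤ)) :=
  {w | IsQuadrantWalk w ∧ w.length = n ∧ w.sum = ((i : ℤ), (j : ℤ))}

theorem walks_finite (i j n : ℕ) : (walks i j n).Finite := by
  refine ((List.finite_length_eq (↥steps) n).image (List.map Subtype.val)).subset ?_
  rintro w ⟨⟨hs, -⟩, hl, -⟩
  lift w to List (↥steps) using hs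
  exact ⟨w, by simpa using hl, rfl⟩

/-- `q i j n` is the number of quarter plane walks of length `n` that end at `(i, j)`. -/
def q (i j n : ℕ) : ℕ := (walks i j n).ncard

theorem sum_le_length (w : List (ℤ × ℤ)) (h : ∀ s ∈ w, s ∈ steps) :
    w.sum.1 ≤ w.length ∧ w.sum.2 ≤ w.length := by
  induction w with
  | nil => simp
  | cons a l ih =>
    have h1 := ih fun s hs => h s (List.mem_cons_of_mem _ hs)
    have h2 : a ∈ steps := h a List.mem_cons_self
    simp only [steps, Finset.mem_insert, Finset.mem_singleton] at h2
    rcases h2 with rfl | rfl | rfl <;> simp <;> omega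

/-- Walks of length `n` end in the square `[0, n] × [0, n]`, so that the finite sums over
`Finset.range (n + 1)` below run over all end points. -/
theorem q_eq_zero (i j n : ℕ) (h : n < i ∨ n < j) : q i j n = 0 := by
  have : walks i j n = ∅ := by
    ext w
    simp only [Set.mem_empty_iff_false, iff_false]
    rintro ⟨⟨hs, -⟩, hl, he⟩
    have := sum_le_length w hs
    rw [he, hl] at this
    simp only [Nat.cast_le] at this
    omega
  rw [q, this, Set.ncard_empty]

/-- `Q(x, y; t) = ∑ q(i, j; n) x^i y^j t^n`, a power series in `t` with coefficients in
`ℚ[x][y]`: the inner variable is `x`, the outer variable is `y`. -/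
def Q : PowerSeries ℚ[X][X] :=
  PowerSeries.mk fun n => ∑ i ∈ Finset.range (n + 1), ∑ j ∈ Finset.range (n + 1),
    monomial j (monomial i (q i j n : ℚ))

/-- `Q(x, 0; t)`: the variable `y` is set to `0`. -/
def Qx0 : PowerSeries ℚ[X] := PowerSeries.map (Polynomial.evalRingHom (0 : ℚ[X])) Q

/-- `Q_d(x; t) = ∑ q(i, i; n) x^i t^n`, the generating function of the walks that end on the
diagonal, a power series in `t` with coefficients in `ℚ[x]`. -/
def Qd : PowerSeries ℚ[X] :=
  PowerSeries.mk fun n => ∑ i ∈ Finset.range (n + 1), monomial i (q i i n : ℚ)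

/-- `[x^i] F(x; t)`, as a power series in `t`. -/
def coeffX (i : ℕ) (F : PowerSeries ℚ[X]) : PowerSeries ℚ :=
  PowerSeries.mk fun n => (PowerSeries.coeff n F).coeff i

/-- The square root of a power series `F` in `t` with constant term `1`, by the binomial series:
`√F = ∑ (1/2 choose k) (F - 1)^k`. -/
def psSqrt {A : Type*} [CommRing A] [Algebra ℚ A] (F : PowerSeries A) : PowerSeries A :=
  (PowerSeries.binomialSeries ℚ (1 / 2 : ℚ)).subst (F - 1)

theorem hasSubst_sub_one {A : Type*} [CommRing A] (F : PowerSeries A)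
    (hF : PowerSeries.constantCoeff F = 1) : PowerSeries.HasSubst (F - 1) :=
  PowerSeries.HasSubst.of_constantCoeff_zero' (by simp [hF])

theorem psSqrt_sq {A : Type*} [CommRing A] [Algebra ℚ A] (F : PowerSeries A)
    (hF : PowerSeries.constantCoeff F = 1) : psSqrt F ^ 2 = F := by
  have hs := hasSubst_sub_one F hF
  rw [psSqrt, ← PowerSeries.subst_pow hs, pow_two, ← PowerSeries.binomialSeries_add]
  have h1 : PowerSeries.binomialSeries ℚ (1 / 2 + 1 / 2 : ℚ) = 1 + PowerSeries.X := by
    have := PowerSeries.binomialSeries_nat (R := ℚ) (A := ℚ) 1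
    norm_num at this ⊢
    exact this
  rw [h1, PowerSeries.subst_add hs, PowerSeries.subst_X hs, ← PowerSeries.coe_substAlgHom hs,
    map_one]
  ring

theorem constantCoeff_psSqrt {A : Type*} [CommRing A] [Algebra ℚ A] (F : PowerSeries A)
    (hF : PowerSeries.constantCoeff F = 1) : PowerSeries.constantCoeff (psSqrt F) = 1 := by
  have hs := hasSubst_sub_one F hF
  have h0 : PowerSeries.constantCoeff (F - 1) = 0 := by simp [hF]
  have h1 : psSqrt F - 1 =
      (PowerSeries.binomialSeries ℚ (1 / 2 : ℚ) - 1).subst (F - 1) := by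
    rw [PowerSeries.subst_sub hs, psSqrt, ← PowerSeries.coe_substAlgHom hs, map_one]
  have h2 : PowerSeries.constantCoeff (psSqrt F - 1) = 0 := by
    rw [h1]
    exact PowerSeries.constantCoeff_subst_eq_zero h0 _ (by simp)
  simpa [sub_eq_zero] using h2

/-- The field `ℚ(x)((t))` of Laurent series in `t` over the rational functions in `x`. -/
abbrev K : Type := LaurentSeries (RatFunc ℚ)

/-- The inclusion of `ℚ[x][[t]]` in `ℚ(x)((t))`. -/
def toK : PowerSeries ℚ[X] →+* K :=
  (HahnSeries.ofPowerSeries ℤ (RatFunc ℚ)).comp (PowerSeries.map (algebraMap ℚ[X] (RatFunc ℚ)))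

/-- The inclusion of `ℚ[[t]]` in `ℚ[x][[t]]`. -/
def constX : PowerSeries ℚ →+* PowerSeries ℚ[X] := PowerSeries.map Polynomial.C

/-- The variable `x`, as an element of `ℚ[x][[t]]`. -/
def varX : PowerSeries ℚ[X] := PowerSeries.C Polynomial.X

/-- The variable `x`, as an element of `ℚ(x)((t))`. -/
def xK : K := toK varX

/-- The variable `t`, as an element of `ℚ(x)((t))`. -/
def tK : K := toK PowerSeries.X

/-- The inclusion of `ℚ[[t]]` in `ℚ(x)((t))`. -/
def seriesK : PowerSeries ℚ →+* K := toK.comp constX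

/-- The inclusion of `ℚ[[t]]` in `ℚ((t))`. -/
def toLaurent : PowerSeries ℚ →+* LaurentSeries ℚ := HahnSeries.ofPowerSeries ℤ ℚ

/-- `1 - x W (W^3 + 4) / 4 + x^2 W^2 / 4`, in `ℚ[x][[t]]`. -/
def deltaPlus (W : PowerSeries ℚ) : PowerSeries ℚ[X] :=
  1 - (1 / 4 : ℚ) • (varX * constX W * (constX W ^ 3 + 4))
    + (1 / 4 : ℚ) • (varX ^ 2 * constX W ^ 2)

/-- `1 - x W^2`, in `ℚ[x][[t]]`. -/
def deltaMinus (W : PowerSeries ℚ) : PowerSeries ℚ[X] := 1 - varX * constX W ^ 2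

end ReverseKreweras

end

open ReverseKreweras

noncomputable section

namespace ReverseKreweras

open Polynomial

/-! ### The step by step recursion for the numbers of walks -/

/-! The proof is the kernel method, applied twice with the same kernel. Removing the last step gives
`kernel_equation_Q`, which involves only Q(x,0) and, by the symmetry of the step set, Q(y,0). At the
small root Y of xY = t(x²Y + xY² + 1) it becomes xY/t = Q(x,0) + Q(Y,0) − Q(0,0)
(`kernel_method_Q`). A t-adic argument (`eq_zero_of_incl_add_subY`) shows that this equation has at
most one solution, so the claimed series only needs to be checked. Its rational part is easy. Its
irrational part S(x) = (2x² − xW² − W)√Δ₊(x)/x satisfies S(x) + S(Y) = 0 (`sqrt_deltaPlus_root`).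

For the diagonal, the walks ending on or below it have a series `V` whose kernel, after x ↦ 1/x, is
that of Q up to a monomial factor. The same Y therefore relates Q_d(1/x), Q(Y,0) and the series `V1`
of end points (j+1, j). Eliminating `V1` with `diagonal_equation` and Q(Y,0) with the first part
leaves Q_d(1/x) times 1 − tx − 2tY. The latter is the root of the discriminant, which factors as (1
− tx)² − 4t²/x = 4Δ₊(x)Δ₋(1/x)/(2 + W³)². The factor √Δ₊(x) cancels, so that only √Δ₋ remains.
Expanding 1/√(1 − xW²) and applying Lagrange inversion to powers of W (`coeff_W_pow`) gives the
coefficients. -/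

/-- The quarter plane walks of length `n` that end at `e`, where `e` may be any lattice point. -/
def walksTo (e : ℤ × ℤ) (n : ℕ) : Set (List (ℤ × ℤ)) :=
  {w | IsQuadrantWalk w ∧ w.length = n ∧ w.sum = e}

theorem IsQuadrantWalk.sum_nonneg {w : List (ℤ × ℤ)} (hw : IsQuadrantWalk w) :
    0 ≤ w.sum.1 ∧ 0 ≤ w.sum.2 := by
  simpa using hw.2 w.length le_rfl

theorem walksTo_eq_empty {e : ℤ × ℤ} (n : ℕ) (he : e.1 < 0 ∨ e.2 < 0) : walksTo e n = ∅ := by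
  ext w
  simp only [walksTo, Set.mem_ofPred_eq, Set.mem_empty_iff_false, iff_false]
  rintro ⟨hw, -, rfl⟩
  have := hw.sum_nonneg
  omega

theorem walksTo_finite (e : ℤ × ℤ) (n : ℕ) : (walksTo e n).Finite := by
  by_cases he : e.1 < 0 ∨ e.2 < 0
  · rw [walksTo_eq_empty n he]
    exact Set.finite_empty
  · push Not at he
    obtain ⟨a, b⟩ := e
    lift a to ℕ using he.1
    lift b to ℕ using he.2
    exact walks_finite a b n

theorem isQuadrantWalk_append_singleton (w : List (ℤ × ℤ)) (s : ℤ × ℤ) :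
    IsQuadrantWalk (w ++ [s]) ↔
      IsQuadrantWalk w ∧ s ∈ steps ∧ 0 ≤ (w.sum + s).1 ∧ 0 ≤ (w.sum + s).2 := by
  constructor
  · rintro ⟨h1, h2⟩
    refine ⟨⟨fun a ha => h1 a (by simp [ha]), fun k hk => ?_⟩, h1 s (by simp), ?_⟩
    · have := h2 k (by simp; omega)
      rwa [List.take_append_of_le_length hk] at this
    · have := h2 (w ++ [s]).length le_rfl
      rwa [List.take_length, List.sum_append, List.sum_singleton] at this
  · rintro ⟨⟨h1, h2⟩, hs, h3⟩
    refine ⟨fun a ha => ?_, fun k hk => ?_⟩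
    · rcases List.mem_append.1 ha with h | h
      · exact h1 a h
      · rw [List.mem_singleton.1 h]
        exact hs
    · rcases Nat.lt_or_ge w.length k with h | h
      · have : (w ++ [s]).take k = w ++ [s] := List.take_of_length_le (by simp; omega)
        rwa [this, List.sum_append, List.sum_singleton]
      · rw [List.take_append_of_le_length h]
        exact h2 k h

/-- Classification by the last step. Arbitrary lattice end points keep the recursion uniform: a
predecessor outside the quadrant contributes the empty set. -/
theorem walksTo_succ {e : ℤ × ℤ} (n : ℕ) (h1 : 0 ≤ e.1) (h2 : 0 ≤ e.2) :
    walksTo e (n + 1) =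
      (· ++ [(0, 1)]) '' walksTo (e - (0, 1)) n ∪
        ((· ++ [(1, 0)]) '' walksTo (e - (1, 0)) n ∪
          (· ++ [(-1, -1)]) '' walksTo (e - (-1, -1)) n) := by
  ext w
  have key : ∀ s ∈ steps,
      w ∈ (· ++ [s]) '' walksTo (e - s) n ↔ ∃ v, w = v ++ [s] ∧ w ∈ walksTo e (n + 1) := by
    intro s hs
    constructor
    · rintro ⟨v, ⟨hv, hl, he⟩, rfl⟩
      refine ⟨v, rfl, (isQuadrantWalk_append_singleton v s).2 ⟨hv, hs, ?_⟩,
        by simp [hl], by simp [he]⟩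
      rw [he, sub_add_cancel]
      exact ⟨h1, h2⟩
    · rintro ⟨v, rfl, hv, hl, he⟩
      refine ⟨v, ⟨((isQuadrantWalk_append_singleton v s).1 hv).1, by simpa using hl, ?_⟩, rfl⟩
      rw [← he, List.sum_append, List.sum_singleton, add_sub_cancel_right]
  simp only [Set.mem_union]
  rw [key _ (by simp [steps]), key _ (by simp [steps]), key _ (by simp [steps])]
  constructor
  · intro hw
    have hne : w ≠ [] := by
      rintro rfl
      simpa using hw.2.1
    have hs := hw.1.1 _ (List.getLast_mem hne)
    have hd : w = w.dropLast ++ [w.getLast hne] := (List.dropLast_append_getLast hne).symm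
    simp only [steps, Finset.mem_insert, Finset.mem_singleton] at hs
    rcases hs with h | h | h <;> rw [h] at hd
    · exact Or.inl ⟨_, hd, hw⟩
    · exact Or.inr (Or.inl ⟨_, hd, hw⟩)
    · exact Or.inr (Or.inr ⟨_, hd, hw⟩)
  · rintro (⟨-, -, h⟩ | ⟨-, -, h⟩ | ⟨-, -, h⟩) <;> exact h

theorem ncard_walksTo_succ {e : ℤ × ℤ} (n : ℕ) (h1 : 0 ≤ e.1) (h2 : 0 ≤ e.2) :
    (walksTo e (n + 1)).ncard =
      (walksTo (e - (0, 1)) n).ncard + (walksTo (e - (1, 0)) n).ncard +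
        (walksTo (e - (-1, -1)) n).ncard := by
  have hinj : ∀ s : ℤ × ℤ, Function.Injective (fun w : List (ℤ × ℤ) => w ++ [s]) :=
    fun s => List.append_left_injective [s]
  have hfin : ∀ s : ℤ × ℤ, ((· ++ [s]) '' walksTo (e - s) n).Finite :=
    fun s => (walksTo_finite _ n).image _
  have hdisj : ∀ s s' : ℤ × ℤ, s ≠ s' →
      Disjoint ((· ++ [s]) '' walksTo (e - s) n) ((· ++ [s']) '' walksTo (e - s') n) := by
    intro s s' hne
    rw [Set.disjoint_left]
    rintro _ ⟨v, -, rfl⟩ ⟨v', -, h⟩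
    exact hne (by simpa using (List.append_inj' h rfl).2.symm)
  rw [walksTo_succ n h1 h2, Set.ncard_union_eq ?_ (hfin _) ((hfin _).union (hfin _)),
    Set.ncard_union_eq (hdisj _ _ (by simp)) (hfin _) (hfin _),
    Set.ncard_image_of_injective _ (hinj _), Set.ncard_image_of_injective _ (hinj _),
    Set.ncard_image_of_injective _ (hinj _), add_assoc]
  exact (hdisj _ _ (by simp)).union_right (hdisj _ _ (by simp))

theorem q_eq_ncard (i j n : ℕ) : q i j n = (walksTo ((i : ℤ), (j : ℤ)) n).ncard := rfl

theorem q_zero_zero_succ (n : ℕ) : q 0 0 (n + 1) = q 1 1 n := by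
  rw [q_eq_ncard, ncard_walksTo_succ n (by simp) (by simp), walksTo_eq_empty (e := _ - (0, 1)),
    walksTo_eq_empty (e := _ - (1, 0)), q_eq_ncard]
  · simp
  all_goals simp

theorem q_succ_zero_succ (i n : ℕ) : q (i + 1) 0 (n + 1) = q i 0 n + q (i + 2) 1 n := by
  rw [q_eq_ncard, ncard_walksTo_succ n (by positivity) (by simp),
    walksTo_eq_empty (e := _ - (0, 1)), q_eq_ncard, q_eq_ncard]
  · simp [add_assoc, one_add_one_eq_two]
  all_goals simp

theorem q_zero_succ_succ (j n : ℕ) : q 0 (j + 1) (n + 1) = q 0 j n + q 1 (j + 2) n := by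
  rw [q_eq_ncard, ncard_walksTo_succ n (by simp) (by positivity),
    walksTo_eq_empty (e := _ - (1, 0)), q_eq_ncard, q_eq_ncard]
  · simp [add_assoc, one_add_one_eq_two]
  all_goals simp

theorem q_succ_succ_succ (i j n : ℕ) :
    q (i + 1) (j + 1) (n + 1) = q (i + 1) j n + q i (j + 1) n + q (i + 2) (j + 2) n := by
  rw [q_eq_ncard, ncard_walksTo_succ n (by positivity) (by positivity), q_eq_ncard, q_eq_ncard,
    q_eq_ncard]
  simp [add_assoc, one_add_one_eq_two]

theorem q_zero_right (i j : ℕ) : q i j 0 = if i = 0 ∧ j = 0 then 1 else 0 := by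
  have : walks i j 0 = if i = 0 ∧ j = 0 then {[]} else ∅ := by
    ext w
    split_ifs with h
    · obtain ⟨rfl, rfl⟩ := h
      simp only [walks, Set.mem_ofPred_eq, Set.mem_singleton_iff]
      constructor
      · rintro ⟨-, hl, -⟩
        simpa using hl
      · rintro rfl
        refine ⟨by simp [IsQuadrantWalk], rfl, ?_⟩
        simp
        rfl
    · simp only [walks, Set.mem_ofPred_eq, Set.mem_empty_iff_false, iff_false]
      rintro ⟨-, hl, he⟩
      obtain rfl : w = [] := by simpa using hl
      simp [Prod.ext_iff] at he
      omega
  rw [q, this]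
  split_ifs <;> simp

theorem q_comm (i j n : ℕ) : q i j n = q j i n := by
  induction n generalizing i j with
  | zero => simp [q_zero_right, and_comm]
  | succ n ih =>
    rcases i with _ | i <;> rcases j with _ | j
    · rfl
    · rw [q_zero_succ_succ, q_succ_zero_succ, ih 0, ih 1]
    · rw [q_zero_succ_succ, q_succ_zero_succ, ih 0, ih 1]
    · rw [q_succ_succ_succ, q_succ_succ_succ, ih (i + 1) j, ih i, ih (i + 2), add_comm (q j _ _)]

/-! ### Functional equations -/

theorem coeff_Q (i j n : ℕ) : ((PowerSeries.coeff n Q).coeff j).coeff i = (q i j n : ℚ) := by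
  simp only [Q, PowerSeries.coeff_mk, finsetSum_coeff, coeff_monomial]
  have : ∀ a b : ℕ, (if b = j then monomial a (q a b n : ℚ) else 0).coeff i =
      if b = j then (if a = i then (q i j n : ℚ) else 0) else 0 := by
    intro a b
    split_ifs with h1 h2 <;> simp_all [coeff_monomial]
  simp only [this, Finset.sum_ite_eq', Finset.mem_range]
  split_ifs with h1
  · simp only [Finset.sum_ite_eq', Finset.mem_range]
    split_ifs with h2
    · rfl
    · rw [q_eq_zero i j n (by omega), Nat.cast_zero]
  · simp [q_eq_zero i j n (by omega)]

theorem coeff_Qx0 (i n : ℕ) : (PowerSeries.coeff n Qx0).coeff i = (q i 0 n : ℚ) := by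
  rw [Qx0, PowerSeries.coeff_map, coe_evalRingHom, ← coeff_zero_eq_eval_zero, coeff_Q]

theorem coeff_Qd (i n : ℕ) : (PowerSeries.coeff n Qd).coeff i = (q i i n : ℚ) := by
  simp only [Qd, PowerSeries.coeff_mk, finsetSum_coeff, coeff_monomial, Finset.sum_ite_eq',
    Finset.mem_range]
  split_ifs with h
  · rfl
  · rw [q_eq_zero i i n (by omega), Nat.cast_zero]

/-- The generating function of the walks that end at the origin. -/
def Q00 : PowerSeries ℚ := coeffX 0 Qd

theorem coeff_Q00 (n : ℕ) : PowerSeries.coeff n Q00 = (q 0 0 n : ℚ) := by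
  rw [Q00, coeffX, PowerSeries.coeff_mk, coeff_Qd]

/-- The inclusion of `ℚ[x][[t]]` in `ℚ[x][y][[t]]`. -/
def inX : PowerSeries ℚ[X] →+* PowerSeries ℚ[X][X] := PowerSeries.map Polynomial.C

/-- The map from `ℚ[x][[t]]` to `ℚ[x][y][[t]]` that replaces `x` by `y`. -/
def inY : PowerSeries ℚ[X] →+* PowerSeries ℚ[X][X] := PowerSeries.map (mapRingHom Polynomial.C)

theorem coeff_coeff_C_mul_X_pow_mul (k l i j : ℕ) (p : ℚ[X][X]) :
    ((C (X ^ k) * X ^ l * p).coeff j).coeff i =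
      if l ≤ j then (if k ≤ i then (p.coeff (j - l)).coeff (i - k) else 0) else 0 := by
  rw [mul_assoc, coeff_C_mul, coeff_X_pow_mul', coeff_X_pow_mul']
  split_ifs <;> simp

theorem coeff_zero_Q : PowerSeries.coeff 0 Q = 1 := by
  ext j i
  rw [coeff_Q, q_zero_right, coeff_one]
  by_cases hj : j = 0 <;> simp [hj, coeff_one]

theorem coeff_coeff_inX (i j n : ℕ) (F : PowerSeries ℚ[X]) :
    ((PowerSeries.coeff n (inX F)).coeff j).coeff i =
      if j = 0 then (PowerSeries.coeff n F).coeff i else 0 := by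
  rw [inX, PowerSeries.coeff_map, coeff_C]
  split_ifs <;> simp

theorem coeff_coeff_inY (i j n : ℕ) (F : PowerSeries ℚ[X]) :
    ((PowerSeries.coeff n (inY F)).coeff j).coeff i =
      if i = 0 then (PowerSeries.coeff n F).coeff j else 0 := by
  rw [inY, PowerSeries.coeff_map, coe_mapRingHom, coeff_map, coeff_C]

theorem coeff_constX (i n : ℕ) (F : PowerSeries ℚ) :
    (PowerSeries.coeff n (constX F)).coeff i = if i = 0 then PowerSeries.coeff n F else 0 := by
  rw [constX, PowerSeries.coeff_map, coeff_C]

/-- The factor xy clears the denominator of the step SW. The subtracted series are the forbidden SW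
steps from the two axes, and the origin, subtracted twice, is added back. -/
theorem kernel_equation_Q :
    PowerSeries.C (C X * X) * Q =
      PowerSeries.C (C X * X) +
        PowerSeries.X * (PowerSeries.C (C (X ^ 2) * X + C X * X ^ 2 + 1) * Q
          - inX Qx0 - inY Qx0 + inX (constX Q00)) := by
  ext n j i
  -- Every monomial, even 1, is put in the shape required by `coeff_coeff_C_mul_X_pow_mul`.
  have h1 : (C X * X : ℚ[X][X]) = C (X ^ 1) * X ^ 1 := by simp
  have h2 : (C (X ^ 2) * X + C X * X ^ 2 + 1 : ℚ[X][X]) =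
    C (X ^ 2) * X ^ 1 + C (X ^ 1) * X ^ 2 + C (X ^ 0) * X ^ 0 := by simp
  rw [h1, h2]
  rcases n with _ | n
  · simp only [map_add, PowerSeries.coeff_C_mul, PowerSeries.coeff_zero_X_mul, coeff_zero_Q,
      PowerSeries.coeff_zero_C, mul_one, add_zero]
  · simp only [map_add, map_sub, add_mul, PowerSeries.coeff_C_mul, coeff_add, coeff_sub,
      PowerSeries.coeff_succ_X_mul, coeff_coeff_C_mul_X_pow_mul, coeff_Q, coeff_coeff_inX,
      coeff_coeff_inY, coeff_constX, coeff_Qx0, coeff_Q00, PowerSeries.coeff_succ_C]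
    rcases i with _ | _ | i <;> rcases j with _ | _ | j <;>
      simp [q_zero_zero_succ, q_succ_zero_succ, q_succ_succ_succ, q_comm 0 (_ + 1)]
    · rw [q_comm 0 j, q_comm 1 (j + 2)]
    · ring

/-- The generating function of the walks that end at `(i, j)` with `j ≤ i`, where the inner
variable counts `j` and the outer variable counts `i - j`. -/
def V : PowerSeries ℚ[X][X] :=
  PowerSeries.mk fun n => ∑ a ∈ Finset.range (n + 1), ∑ j ∈ Finset.range (n + 1),
    monomial a (monomial j (q (j + a) j n : ℚ))

theorem coeff_V (a j n : ℕ) :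
    ((PowerSeries.coeff n V).coeff a).coeff j = (q (j + a) j n : ℚ) := by
  simp only [V, PowerSeries.coeff_mk, finsetSum_coeff, coeff_monomial]
  have : ∀ a' b : ℕ, (if a' = a then monomial b (q (b + a') b n : ℚ) else 0).coeff j =
      if b = j then (if a' = a then (q (j + a) j n : ℚ) else 0) else 0 := by
    intro a b
    split_ifs with h1 h2 <;> simp_all [coeff_monomial]
  simp only [this, Finset.sum_ite_eq', Finset.mem_range]
  split_ifs with h1
  · simp only [Finset.sum_ite_eq', Finset.mem_range]
    split_ifs with h2
    · rfl
    · rw [q_eq_zero _ j n (by omega), Nat.cast_zero]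
  · simp [q_eq_zero _ j n (Or.inr (by omega))]

/-- The generating function of the walks that end at `(j + 1, j)`, where `x` counts `j`. -/
def V1 : PowerSeries ℚ[X] := PowerSeries.mk fun n => (PowerSeries.coeff n V).coeff 1

theorem coeff_V1 (j n : ℕ) : (PowerSeries.coeff n V1).coeff j = (q (j + 1) j n : ℚ) := by
  rw [V1, PowerSeries.coeff_mk, coeff_V]

theorem coeff_zero_V : PowerSeries.coeff 0 V = 1 := by
  ext j i
  rw [coeff_V, q_zero_right, coeff_one]
  by_cases hj : j = 0 <;> by_cases hi : i = 0 <;> simp [hj, hi, coeff_one]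

/-- In these coordinates N, E, SW have weights x/y, y, 1/x. The corrections remove N steps from the
diagonal and SW steps from the x-axis, and add E steps that reach the diagonal from above; by
symmetry `V1` counts the latter. -/
theorem kernel_equation_V :
    PowerSeries.C (C X * X) * V =
      PowerSeries.C (C X * X) +
        PowerSeries.X * (PowerSeries.C (C X * X ^ 2 + C (X ^ 2) + X) * V
          - PowerSeries.C (C (X ^ 2)) * inX Qd - PowerSeries.C X * inY Qx0
          + PowerSeries.C (C (X ^ 2) * X) * inX V1) := by
  ext n j i
  have h1 : (C X * X : ℚ[X][X]) = C (X ^ 1) * X ^ 1 := by simp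
  have h2 : (C X * X ^ 2 + C (X ^ 2) + X : ℚ[X][X]) =
    C (X ^ 1) * X ^ 2 + C (X ^ 2) * X ^ 0 + C (X ^ 0) * X ^ 1 := by simp
  have h3 : PowerSeries.C (C (X ^ 2) * X) * inX V1 =
      PowerSeries.C (C (X ^ 2) * X ^ 1) * inX V1 := by
    simp
  have h4 : PowerSeries.C (C (X ^ 2)) * inX Qd = PowerSeries.C (C (X ^ 2) * X ^ 0) * inX Qd := by
    simp
  have h5 : PowerSeries.C X * inY Qx0 = PowerSeries.C (C (X ^ 0) * X ^ 1) * inY Qx0 := by simp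
  rw [h1, h2, h3, h4, h5]
  rcases n with _ | n
  · simp only [map_add, PowerSeries.coeff_C_mul, PowerSeries.coeff_zero_X_mul, coeff_zero_V,
      PowerSeries.coeff_zero_C, mul_one, add_zero]
  · simp only [map_add, map_sub, add_mul, PowerSeries.coeff_C_mul, coeff_add, coeff_sub,
      PowerSeries.coeff_succ_X_mul, coeff_coeff_C_mul_X_pow_mul, coeff_V, coeff_coeff_inX,
      coeff_coeff_inY, coeff_Qx0, coeff_Qd, coeff_V1, PowerSeries.coeff_succ_C]
    rcases i with _ | _ | i <;> rcases j with _ | _ | j <;>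
      simp [q_zero_zero_succ, q_succ_zero_succ, q_succ_succ_succ]
    · rw [add_left_comm]
    · rw [q_comm i (i + 1)]
      ring
    · rw [show i + 1 + (j + 1) = i + j + 1 + 1 by ring, q_succ_succ_succ]
      push_cast
      ring_nf

/-- The factor 2 accounts for arrivals on the diagonal by N and by E, which are equinumerous by
symmetry. -/
theorem diagonal_equation :
    PowerSeries.C X * Qd =
      PowerSeries.C X +
        PowerSeries.X * (2 * PowerSeries.C (X ^ 2) * V1 + Qd - constX Q00) := by
  ext n j
  have h1 : (2 * PowerSeries.C (X ^ 2) * V1 : PowerSeries ℚ[X]) =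
      PowerSeries.C (X ^ 2) * V1 + PowerSeries.C (X ^ 2) * V1 := by ring
  rw [h1]
  rcases n with _ | n
  · have h2 : PowerSeries.coeff 0 Qd = 1 := by
      ext i
      rw [coeff_Qd, q_zero_right, coeff_one]
      simp
    simp only [map_add, PowerSeries.coeff_C_mul, PowerSeries.coeff_zero_X_mul, h2,
      PowerSeries.coeff_zero_C, mul_one, add_zero]
  · simp only [map_add, map_sub, PowerSeries.coeff_C_mul, coeff_add, coeff_sub,
      PowerSeries.coeff_succ_X_mul, coeff_Qd, coeff_V1, coeff_constX, coeff_Q00,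
      PowerSeries.coeff_succ_C, coeff_X_pow_mul']
    rcases j with _ | _ | j
    · simp
    · simp [coeff_Qd, q_zero_zero_succ]
    · simp [coeff_Qd, q_succ_succ_succ, q_comm j (j + 1)]

/-! ### Homomorphisms of power series rings -/

section EvalHom

theorem exists_C_add_X_mul {R : Type*} [CommRing R] (F : PowerSeries R) :
    ∃ G, F = PowerSeries.C (PowerSeries.constantCoeff F) + PowerSeries.X * G :=
  ⟨_, by rw [add_comm]; exact PowerSeries.eq_X_mul_shift_add_const F⟩

theorem eq_zero_of_forall_X_pow_dvd {R : Type*} [CommRing R] {F : PowerSeries R}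
    (h : ∀ n : ℕ, PowerSeries.X ^ n ∣ F) : F = 0 := by
  ext n
  exact PowerSeries.X_pow_dvd_iff.1 (h (n + 1)) n n.lt_succ_self

/-- No continuity assumption is needed: writing F = c + tG repeatedly shows that f F − g F is
divisible by every power of t. -/
theorem ringHom_powerSeries_ext {R S : Type*} [CommRing R] [CommRing S]
    {f g : PowerSeries R →+* PowerSeries S}
    (hC : ∀ r, f (PowerSeries.C r) = g (PowerSeries.C r))
    (hf : f PowerSeries.X = PowerSeries.X) (hg : g PowerSeries.X = PowerSeries.X) : f = g := by
  have key : ∀ (n : ℕ) (F : PowerSeries R), PowerSeries.X ^ n ∣ f F - g F := by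
    intro n
    induction n with
    | zero => simp
    | succ n ih =>
      intro F
      obtain ⟨G, hG⟩ := exists_C_add_X_mul F
      have : f F - g F = PowerSeries.X * (f G - g G) := by
        rw [hG, map_add, map_add, map_mul, map_mul, hC, hf, hg]
        ring
      rw [this, pow_succ']
      exact mul_dvd_mul_left _ (ih G)
  exact RingHom.ext fun F => sub_eq_zero.1 (eq_zero_of_forall_X_pow_dvd fun n => key n F)

open scoped PowerSeries.WithPiTopology in
/-- A homomorphism from `R` to `k[[t]]` extends to a homomorphism from `R[[t]]` to `k[[t]]` that
fixes `t`. -/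
theorem exists_extension {R k : Type*} [CommRing R] [Field k] (φ : R →+* PowerSeries k) :
    ∃ f : PowerSeries R →+* PowerSeries k,
      (∀ r, f (PowerSeries.C r) = φ r) ∧ f PowerSeries.X = PowerSeries.X := by
  -- Discrete uniformities make φ continuous, and t is topologically nilpotent in k[[t]], so power
  -- series can be evaluated at t.
  let _ : UniformSpace R := ⊥
  let _ : UniformSpace k := ⊥
  have : DiscreteUniformity R := ⟨rfl⟩
  have : DiscreteUniformity k := ⟨rfl⟩
  have hφ : Continuous φ := continuous_of_discreteTopology
  have hX : PowerSeries.HasEval (PowerSeries.X : PowerSeries k) := PowerSeries.HasEval.X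
  refine ⟨PowerSeries.eval₂Hom hφ hX, fun r => ?_, ?_⟩
  · rw [PowerSeries.coe_eval₂Hom]
    exact PowerSeries.eval₂_C _ _ _
  · rw [PowerSeries.coe_eval₂Hom]
    exact PowerSeries.eval₂_X _ _

/-- The extension of a homomorphism from `R` to `k[[t]]` to a homomorphism from `R[[t]]`
to `k[[t]]` that fixes `t`. -/
def extend {R k : Type*} [CommRing R] [Field k] (φ : R →+* PowerSeries k) :
    PowerSeries R →+* PowerSeries k :=
  (exists_extension φ).choose

@[simp]
theorem extend_C {R k : Type*} [CommRing R] [Field k] (φ : R →+* PowerSeries k) (r : R) :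
    extend φ (PowerSeries.C r) = φ r :=
  (exists_extension φ).choose_spec.1 r

@[simp]
theorem extend_X {R k : Type*} [CommRing R] [Field k] (φ : R →+* PowerSeries k) :
    extend φ PowerSeries.X = PowerSeries.X :=
  (exists_extension φ).choose_spec.2

theorem constantCoeff_extend {R k : Type*} [CommRing R] [Field k] (φ : R →+* PowerSeries k)
    (F : PowerSeries R) :
    PowerSeries.constantCoeff (extend φ F) =
      PowerSeries.constantCoeff (φ (PowerSeries.constantCoeff F)) := by
  obtain ⟨G, hG⟩ := exists_C_add_X_mul F
  conv_lhs => rw [hG]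
  simp

theorem extend_comp_map {R S k : Type*} [CommRing R] [CommRing S] [Field k]
    (φ : R →+* PowerSeries k) (ψ : S →+* R) (F : PowerSeries S) :
    extend φ (PowerSeries.map ψ F) = extend (φ.comp ψ) F := by
  have : (extend φ).comp (PowerSeries.map ψ) = extend (φ.comp ψ) :=
    ringHom_powerSeries_ext (by simp) (by simp) (by simp)
  exact RingHom.congr_fun this F

theorem extend_C_comp {R k : Type*} [CommRing R] [Field k] (ψ : R →+* k) (F : PowerSeries R) :
    extend ((PowerSeries.C).comp ψ) F = PowerSeries.map ψ F := by
  have : extend ((PowerSeries.C).comp ψ) = PowerSeries.map ψ :=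
    ringHom_powerSeries_ext (by simp) (by simp) (by simp)
  exact RingHom.congr_fun this F

end EvalHom

/-! ### The series `W` -/

/-- The map W ↦ t(2 + W³) is a t-adic contraction, since A³ − B³ is a multiple of A − B. The
solution is the limit of the iterates from 0. -/
theorem existsUnique_W : ∃! W : PowerSeries ℚ, W = PowerSeries.X * (2 + W ^ 3) := by
  let g : PowerSeries ℚ → PowerSeries ℚ := fun W => PowerSeries.X * (2 + W ^ 3)
  have hg : ∀ A B, g A - g B = PowerSeries.X * (A ^ 2 + A * B + B ^ 2) * (A - B) := by
    intro A B
    simp only [g]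
    ring
  have hg' : ∀ n A B, PowerSeries.X ^ n ∣ A - B → PowerSeries.X ^ (n + 1) ∣ g A - g B := by
    intro n A B h
    rw [hg, pow_succ']
    exact mul_dvd_mul (Dvd.intro _ rfl) h
  let w : ℕ → PowerSeries ℚ := fun n => g^[n] 0
  have hw : ∀ n, w (n + 1) = g (w n) := fun n => Function.iterate_succ_apply' g n 0
  have h1 : ∀ n, PowerSeries.X ^ n ∣ w (n + 1) - w n := by
    intro n
    induction n with
    | zero => simp
    | succ n ih =>
      rw [hw (n + 1), hw n]
      exact hg' n _ _ (hw n ▸ ih)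
  have h2 : ∀ n m, PowerSeries.X ^ n ∣ w (n + m) - w n := by
    intro n m
    induction m with
    | zero => simp
    | succ m ih =>
      have := dvd_add ((pow_dvd_pow _ (Nat.le_add_right n m)).trans (h1 (n + m))) ih
      rwa [sub_add_sub_cancel] at this
  -- The coefficient of tⁿ is constant from iterate n + 1 on.
  let W : PowerSeries ℚ := PowerSeries.mk fun n => PowerSeries.coeff n (w (n + 1))
  have h3 : ∀ n, PowerSeries.X ^ n ∣ W - w n := by
    intro n
    rw [PowerSeries.X_pow_dvd_iff]
    intro m hm
    have := PowerSeries.X_pow_dvd_iff.1 (h2 (m + 1) (n - (m + 1))) m m.lt_succ_self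
    rw [Nat.add_sub_cancel' hm, map_sub] at this
    rw [map_sub, PowerSeries.coeff_mk, ← neg_sub, this, neg_zero]
  refine ⟨W, sub_eq_zero.1 (eq_zero_of_forall_X_pow_dvd fun n => ?_), fun B hB => ?_⟩
  · have h4 := (pow_dvd_pow PowerSeries.X n.le_succ).trans (hg' n _ _ (h3 n))
    have h5 := (pow_dvd_pow PowerSeries.X n.le_succ).trans (h3 (n + 1))
    have h6 : W - g W = W - w (n + 1) - (g W - g (w n)) := by
      rw [hw]
      ring
    change _ ∣ W - g W
    rw [h6]
    exact dvd_sub h5 h4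
  · have h4 : ∀ n, PowerSeries.X ^ n ∣ B - w n := by
      intro n
      induction n with
      | zero => simp
      | succ n ih =>
        have := hg' n _ _ ih
        rwa [← hw, ← show B = g B from hB] at this
    refine sub_eq_zero.1 (eq_zero_of_forall_X_pow_dvd fun n => ?_)
    have := dvd_sub (h4 n) (h3 n)
    rwa [sub_sub_sub_cancel_right] at this

theorem constantCoeff_W {W : PowerSeries ℚ} (hW : W = PowerSeries.X * (2 + W ^ 3)) :
    PowerSeries.constantCoeff W = 0 := by
  rw [hW]
  simp

theorem coeff_W_pow_succ_succ {W : PowerSeries ℚ} (hW : W = PowerSeries.X * (2 + W ^ 3))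
    (k n : ℕ) : PowerSeries.coeff (n + 1) (W ^ (k + 1)) =
      2 * PowerSeries.coeff n (W ^ k) + PowerSeries.coeff n (W ^ (k + 3)) := by
  have : W ^ (k + 1) = PowerSeries.X * (PowerSeries.C 2 * W ^ k + W ^ (k + 3)) := by
    rw [pow_succ]
    nth_rw 2 [hW]
    rw [show (PowerSeries.C (2 : ℚ)) = 2 from map_ofNat _ 2]
    ring
  rw [this, PowerSeries.coeff_succ_X_mul, map_add, PowerSeries.coeff_C_mul]

theorem coeff_W_pow_of_lt {W : PowerSeries ℚ} (hW : W = PowerSeries.X * (2 + W ^ 3))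
    {k n : ℕ} (h : n < k) : PowerSeries.coeff n (W ^ k) = 0 := by
  have h1 : PowerSeries.X ^ k ∣ W ^ k := pow_dvd_pow_of_dvd (Dvd.intro _ hW.symm) k
  exact PowerSeries.X_pow_dvd_iff.1 h1 n h

theorem coeff_W_pow_self {W : PowerSeries ℚ} (hW : W = PowerSeries.X * (2 + W ^ 3)) (k : ℕ) :
    PowerSeries.coeff k (W ^ k) = 2 ^ k := by
  induction k with
  | zero => simp
  | succ k ih =>
    rw [coeff_W_pow_succ_succ hW, ih, coeff_W_pow_of_lt hW (by omega)]
    ring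

/-- Lagrange inversion for the powers of `W`. -/
theorem coeff_W_pow {W : PowerSeries ℚ} (hW : W = PowerSeries.X * (2 + W ^ 3)) (j k : ℕ) :
    ((k : ℚ) + 3 * j) * PowerSeries.coeff (k + 3 * j) (W ^ k) =
      k * 2 ^ (k + 2 * j) * (k + 3 * j).choose j := by
  -- Double induction through W^(k+1) = t(2W^k + W^(k+3)): the first term has the same j and a
  -- smaller k, the second has j lowered by one.
  induction j generalizing k with
  | zero => simp [coeff_W_pow_self hW]
  | succ j ihj =>
    induction k with
    | zero => simp [PowerSeries.coeff_one]
    | succ k ihk =>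
      have h1 := ihj (k + 3)
      rw [show k + 1 + 3 * (j + 1) = (k + 3 * (j + 1)) + 1 by ring, coeff_W_pow_succ_succ hW]
      rw [show k + 3 + 3 * j = k + 3 * (j + 1) by ring] at h1
      have h2 : ((k + 3 * (j + 1) + 1).choose (j + 1) : ℚ) * (j + 1) =
          (k + 3 * (j + 1) + 1) * (k + 3 * (j + 1)).choose j := by
        have := Nat.add_one_mul_choose_eq (k + 3 * (j + 1)) j
        exact_mod_cast this.symm
      have h3 : ((k + 3 * (j + 1)).choose (j + 1) : ℚ) =
          (k + 3 * (j + 1) + 1).choose (j + 1) - (k + 3 * (j + 1)).choose j := by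
        rw [Nat.choose_succ_succ']
        push_cast
        ring
      rw [h3] at ihk
      set a := PowerSeries.coeff (k + 3 * (j + 1)) (W ^ k)
      set b := PowerSeries.coeff (k + 3 * (j + 1)) (W ^ (k + 3))
      set c : ℚ := ((k + 3 * (j + 1)).choose j : ℚ)
      set d : ℚ := ((k + 3 * (j + 1) + 1).choose (j + 1) : ℚ)
      have hn : (k + 3 * (j + 1) : ℚ) ≠ 0 := by positivity
      push_cast at ihk h1 ⊢
      refine mul_left_cancel₀ hn ?_
      have h4 : (2 : ℚ) ^ (k + 3 + 2 * j) = 2 * 2 ^ (k + 2 * (j + 1)) := by ring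
      have h5 : (2 : ℚ) ^ (k + 1 + 2 * (j + 1)) = 2 * 2 ^ (k + 2 * (j + 1)) := by ring
      rw [h4] at h1
      rw [h5]
      linear_combination 2 * (k + 1 + 3 * (j + 1) : ℚ) * ihk + (k + 1 + 3 * (j + 1) : ℚ) * h1
        - 2 * 3 * 2 ^ (k + 2 * (j + 1)) * h2

/-! ### Substitutions in power series over `ℚ[x]` -/

/-- `F(0; t)`. -/
def evalZero : PowerSeries ℚ[X] →+* PowerSeries ℚ := PowerSeries.map (evalRingHom 0)

@[simp]
theorem evalZero_varX : evalZero varX = 0 := by simp [evalZero, varX]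

@[simp]
theorem evalZero_X : evalZero PowerSeries.X = PowerSeries.X := by simp [evalZero]

@[simp]
theorem evalZero_constX (F : PowerSeries ℚ) : evalZero (constX F) = F := by
  ext n
  simp [evalZero, constX]

theorem evalZero_Qx0 : evalZero Qx0 = Q00 := by
  ext n
  rw [evalZero, PowerSeries.coeff_map, coe_evalRingHom, ← coeff_zero_eq_eval_zero, coeff_Qx0,
    coeff_Q00]

theorem exists_eq_varX_mul {F : PowerSeries ℚ[X]} (hF : evalZero F = 0) :
    ∃ G, F = varX * G := by
  refine ⟨PowerSeries.mk fun n => (PowerSeries.coeff n F).divX, ?_⟩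
  ext1 n
  have h : (PowerSeries.coeff n F).coeff 0 = 0 := by
    have := congrArg (PowerSeries.coeff n) hF
    rwa [evalZero, PowerSeries.coeff_map, coe_evalRingHom, ← coeff_zero_eq_eval_zero,
      map_zero] at this
  rw [varX, PowerSeries.coeff_C_mul, PowerSeries.coeff_mk]
  conv_lhs => rw [← X_mul_divX_add (PowerSeries.coeff n F), h, C_0, add_zero]

@[simp]
theorem constX_X : constX PowerSeries.X = PowerSeries.X := by simp [constX]

/-- The ring `ℚ(x)[[t]]`. -/
abbrev A : Type := PowerSeries (RatFunc ℚ)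

/-- The variable `x` in `ℚ(x)[[t]]`. -/
def xA : A := PowerSeries.C RatFunc.X

/-- The inverse of `x` in `ℚ(x)[[t]]`. -/
def xbarA : A := PowerSeries.C RatFunc.X⁻¹

/-- The inclusion of `ℚ[[t]]` in `ℚ(x)[[t]]`. -/
def cst : PowerSeries ℚ →+* A := PowerSeries.map (algebraMap ℚ (RatFunc ℚ))

/-- The inclusion of `ℚ[x][[t]]` in `ℚ(x)[[t]]`. -/
def incl : PowerSeries ℚ[X] →+* A := PowerSeries.map (algebraMap ℚ[X] (RatFunc ℚ))

/-- The map `F(x; t) ↦ F(1/x; t)`. -/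
def invX : PowerSeries ℚ[X] →+* A :=
  PowerSeries.map (aeval (RatFunc.X⁻¹ : RatFunc ℚ) : ℚ[X] →ₐ[ℚ] RatFunc ℚ).toRingHom

/-- The map `F(x; t) ↦ F(Y; t)`. -/
def subY (Y : A) : PowerSeries ℚ[X] →+* A :=
  extend (eval₂RingHom ((PowerSeries.C).comp (algebraMap ℚ (RatFunc ℚ))) Y)

theorem xA_mul_xbarA : xA * xbarA = 1 := by
  rw [xA, xbarA, ← map_mul, mul_inv_cancel₀ RatFunc.X_ne_zero, map_one]

theorem xA_ne_zero : xA ≠ 0 := left_ne_zero_of_mul_eq_one xA_mul_xbarA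

@[simp]
theorem incl_varX : incl varX = xA := by simp [incl, varX, xA]

@[simp]
theorem incl_X : incl PowerSeries.X = PowerSeries.X := by simp [incl]

@[simp]
theorem incl_constX (F : PowerSeries ℚ) : incl (constX F) = cst F := by
  ext n
  simp only [incl, constX, cst, PowerSeries.coeff_map, ← algebraMap_eq,
    ← IsScalarTower.algebraMap_apply ℚ ℚ[X] (RatFunc ℚ)]

@[simp]
theorem invX_varX : invX varX = xbarA := by simp [invX, varX, xbarA]

@[simp]
theorem invX_X : invX PowerSeries.X = PowerSeries.X := by simp [invX]

@[simp]
theorem invX_constX (F : PowerSeries ℚ) : invX (constX F) = cst F := by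
  ext n
  simp [invX, constX, cst]

@[simp]
theorem subY_varX (Y : A) : subY Y varX = Y := by simp [subY, varX]

@[simp]
theorem subY_X (Y : A) : subY Y PowerSeries.X = PowerSeries.X := by simp [subY]

@[simp]
theorem subY_constX (Y : A) (F : PowerSeries ℚ) : subY Y (constX F) = cst F := by
  rw [subY, constX, extend_comp_map, cst, ← extend_C_comp]
  congr 2
  ext
  simp

@[simp]
theorem cst_X : cst PowerSeries.X = PowerSeries.X := by simp [cst]

theorem incl_injective : Function.Injective incl :=
  PowerSeries.map_injective _ (IsFractionRing.injective ℚ[X] (RatFunc ℚ))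

theorem invX_injective : Function.Injective invX := by
  refine PowerSeries.map_injective _ ?_
  have hX : Transcendental ℚ (RatFunc.X : RatFunc ℚ) := by
    rw [← RatFunc.algebraMap_X, transcendental_algebraMap_iff (RatFunc.algebraMap_injective ℚ)]
    exact transcendental_X ℚ
  have h : Transcendental ℚ (RatFunc.X⁻¹ : RatFunc ℚ) :=
    fun h => hX (IsAlgebraic.inv_iff.1 h)
  exact transcendental_iff_injective.1 h

theorem constantCoeff_subY {Y : A} (hY : PowerSeries.constantCoeff Y = 0) (F : PowerSeries ℚ[X]) :
    PowerSeries.constantCoeff (subY Y F) =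
      algebraMap ℚ[X] (RatFunc ℚ) (C ((PowerSeries.constantCoeff F).coeff 0)) := by
  rw [subY, constantCoeff_extend, coe_eval₂RingHom, hom_eval₂, hY, eval₂_at_zero]
  simp [← algebraMap_eq]

/-- Since Y = O(t), the lowest t-coefficient d(x) of D would satisfy d(x) + d(0) = d(0). Dividing by
t and repeating shows that D is divisible by every power of t. -/
theorem eq_zero_of_incl_add_subY {Y : A} (hY : PowerSeries.constantCoeff Y = 0)
    {D : PowerSeries ℚ[X]} (hD : incl D + subY Y D = cst (evalZero D)) : D = 0 := by
  refine eq_zero_of_forall_X_pow_dvd fun n => ?_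
  induction n with
  | zero => simp
  | succ n ih =>
    obtain ⟨G, rfl⟩ := ih
    have h1 : incl G + subY Y G = cst (evalZero G) := by
      refine mul_left_cancel₀ (pow_ne_zero n (PowerSeries.X_ne_zero (R := RatFunc ℚ))) ?_
      simpa [mul_add] using hD
    have h2 := congrArg PowerSeries.constantCoeff h1
    rw [map_add, constantCoeff_subY hY] at h2
    have h3 : PowerSeries.constantCoeff (cst (evalZero G)) =
        algebraMap ℚ[X] (RatFunc ℚ) (C ((PowerSeries.constantCoeff G).coeff 0)) := by
      rw [← incl_constX]
      simp only [incl, constX, evalZero, ← PowerSeries.coeff_zero_eq_constantCoeff_apply,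
        PowerSeries.coeff_map, coeff_zero_eq_eval_zero, coe_evalRingHom]
    rw [h3, add_eq_right, incl, ← PowerSeries.coeff_zero_eq_constantCoeff_apply,
      PowerSeries.coeff_map, map_eq_zero_iff _ (IsFractionRing.injective ℚ[X] (RatFunc ℚ)),
      PowerSeries.coeff_zero_eq_constantCoeff_apply, ← PowerSeries.X_dvd_iff] at h2
    rw [pow_succ]
    exact mul_dvd_mul_left _ h2

/-! ### The kernel method -/

/-- The map `F(x, y; t) ↦ F(x, Y; t)`, where `x` is replaced by its image under `ψ`. -/
def subXY (ψ : ℚ[X] →+* RatFunc ℚ) (Y : A) : PowerSeries ℚ[X][X] →+* A :=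
  extend (eval₂RingHom ((PowerSeries.C).comp ψ) Y)

theorem subXY_inX (ψ : ℚ[X] →+* RatFunc ℚ) (Y : A) (F : PowerSeries ℚ[X]) :
    subXY ψ Y (inX F) = PowerSeries.map ψ F := by
  rw [subXY, inX, extend_comp_map, ← extend_C_comp]
  congr 2
  ext <;> simp

theorem subXY_inY (ψ : ℚ[X] →+* RatFunc ℚ) (Y : A) (F : PowerSeries ℚ[X]) :
    subXY ψ Y (inY F) = subY Y F := by
  rw [subXY, inY, extend_comp_map, subY]
  congr 2
  ext1
  · ext1 r
    have h : ψ (C r) = r := eq_ratCast (ψ.comp C) r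
    simp only [RingHom.comp_apply, coe_mapRingHom, map_C, coe_eval₂RingHom, eval₂_C, h,
      eq_ratCast]
  · simp

theorem kernel_method_Q {Y : A} (hY : xA * Y = PowerSeries.X * (xA ^ 2 * Y + xA * Y ^ 2 + 1)) :
    xA * Y = PowerSeries.X * (incl Qx0 + subY Y Qx0 - cst Q00) := by
  have h := congrArg (subXY (algebraMap ℚ[X] (RatFunc ℚ)) Y) kernel_equation_Q
  simp only [map_mul, map_add, map_sub, map_one, map_pow, subXY_inX, subXY_inY] at h
  have h1 : subXY (algebraMap ℚ[X] (RatFunc ℚ)) Y (PowerSeries.C (C X)) = xA := by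
    simp [subXY, xA]
  have h2 : subXY (algebraMap ℚ[X] (RatFunc ℚ)) Y (PowerSeries.C X) = Y := by
    simp [subXY]
  have h3 : subXY (algebraMap ℚ[X] (RatFunc ℚ)) Y PowerSeries.X = PowerSeries.X := by
    simp [subXY]
  have h4 := incl_constX Q00
  rw [h1, h2, h3] at h
  rw [incl] at h4 ⊢
  rw [h4] at h
  linear_combination -h + subXY (algebraMap ℚ[X] (RatFunc ℚ)) Y Q * hY

/-- Replacing x by 1/x in the kernel of `V` and multiplying by x² gives the kernel of `Q`, so the
same Y cancels it. -/
theorem kernel_method_V {Y : A} (hY : xA * Y = PowerSeries.X * (xA ^ 2 * Y + xA * Y ^ 2 + 1)) :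
    xbarA * Y = PowerSeries.X * (xbarA ^ 2 * invX Qd + Y * subY Y Qx0
      - xbarA ^ 2 * Y * invX V1) := by
  have h := congrArg
    (subXY (aeval (RatFunc.X⁻¹ : RatFunc ℚ) : ℚ[X] →ₐ[ℚ] RatFunc ℚ).toRingHom Y) kernel_equation_V
  simp only [map_mul, map_add, map_sub, map_pow, subXY_inX, subXY_inY] at h
  rw [← invX] at h
  set f := subXY (aeval (RatFunc.X⁻¹ : RatFunc ℚ) : ℚ[X] →ₐ[ℚ] RatFunc ℚ).toRingHom Y with hf
  have h1 : f (PowerSeries.C (C X)) = xbarA := by simp [hf, subXY, xbarA]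
  have h2 : f (PowerSeries.C X) = Y := by simp [hf, subXY]
  have h3 : f PowerSeries.X = PowerSeries.X := by simp [hf, subXY]
  rw [h1, h2, h3] at h
  have hY' : xbarA * Y = PowerSeries.X * (xbarA * Y ^ 2 + xbarA ^ 2 + Y) := by
    linear_combination xbarA ^ 2 * hY + (-xbarA * Y + PowerSeries.X * (xbarA * Y ^ 2
      + xA * xbarA * Y + Y)) * xA_mul_xbarA
  linear_combination -h + f V * hY'

/-! ### The factored discriminant, the small root, and the closed forms -/

theorem quarter_smul {R : Type*} [CommRing R] [Algebra ℚ R] (a : R) :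
    4 * ((1 / 4 : ℚ) • a) = a := by
  rw [Algebra.smul_def, ← mul_assoc, ← map_ofNat (algebraMap ℚ R) 4, ← map_mul]
  norm_num

theorem four_mul_deltaPlus (W : PowerSeries ℚ) :
    4 * deltaPlus W = 4 - varX * constX W * (constX W ^ 3 + 4) + varX ^ 2 * constX W ^ 2 := by
  rw [deltaPlus, mul_add, mul_sub, quarter_smul, quarter_smul, mul_one]

section

variable {W : PowerSeries ℚ}

theorem constantCoeff_constX (F : PowerSeries ℚ) :
    PowerSeries.constantCoeff (constX F) = C (PowerSeries.constantCoeff F) := by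
  simp only [constX, ← PowerSeries.coeff_zero_eq_constantCoeff_apply, PowerSeries.coeff_map]

theorem constantCoeff_deltaPlus (hW : W = PowerSeries.X * (2 + W ^ 3)) :
    PowerSeries.constantCoeff (deltaPlus W) = 1 := by
  have h := congrArg PowerSeries.constantCoeff (four_mul_deltaPlus W)
  simp only [map_mul, map_add, map_sub, map_pow, constantCoeff_constX, constantCoeff_W hW,
    map_ofNat] at h
  simpa using h

theorem constantCoeff_deltaMinus (hW : W = PowerSeries.X * (2 + W ^ 3)) :
    PowerSeries.constantCoeff (deltaMinus W) = 1 := by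
  simp [deltaMinus, constantCoeff_constX, constantCoeff_W hW]

/-- The small root of the kernel. -/
theorem exists_root (hW : W = PowerSeries.X * (2 + W ^ 3)) :
    ∃ Y : A, xA * Y = PowerSeries.X * (xA ^ 2 * Y + xA * Y ^ 2 + 1) ∧
      (1 - PowerSeries.X * xA - 2 * PowerSeries.X * Y) * (2 + cst W ^ 3) =
        2 * incl (psSqrt (deltaPlus W)) * invX (psSqrt (deltaMinus W)) := by
  have hp : PowerSeries.constantCoeff (incl (psSqrt (deltaPlus W))) = 1 := by
    have := constantCoeff_psSqrt _ (constantCoeff_deltaPlus hW)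
    rw [← PowerSeries.coeff_zero_eq_constantCoeff_apply] at this ⊢
    rw [incl, PowerSeries.coeff_map, this, map_one]
  have hm : PowerSeries.constantCoeff (invX (psSqrt (deltaMinus W))) = 1 := by
    have := constantCoeff_psSqrt _ (constantCoeff_deltaMinus hW)
    rw [← PowerSeries.coeff_zero_eq_constantCoeff_apply] at this ⊢
    rw [invX, PowerSeries.coeff_map, this, map_one]
  have hp2 : 4 * incl (psSqrt (deltaPlus W)) ^ 2 =
      4 - xA * cst W * (cst W ^ 3 + 4) + xA ^ 2 * cst W ^ 2 := by
    rw [← map_pow, psSqrt_sq _ (constantCoeff_deltaPlus hW)]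
    simpa [map_ofNat] using congrArg incl (four_mul_deltaPlus W)
  have hm2 : invX (psSqrt (deltaMinus W)) ^ 2 = 1 - xbarA * cst W ^ 2 := by
    rw [← map_pow, psSqrt_sq _ (constantCoeff_deltaMinus hW)]
    simp [deltaMinus]
  have hw : cst W = PowerSeries.X * (2 + cst W ^ 3) := by
    simpa [map_ofNat] using congrArg cst hW
  have hw0 : PowerSeries.constantCoeff (cst W) = 0 := by
    rw [hw]
    simp
  have hx := xA_mul_xbarA
  set p := incl (psSqrt (deltaPlus W))
  set m := invX (psSqrt (deltaMinus W))
  set w := cst W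
  have hu : (2 + w ^ 3) * (2 + w ^ 3)⁻¹ = 1 :=
    PowerSeries.mul_inv_cancel _ (by simp [hw0, map_ofNat])
  set u := (2 + w ^ 3)⁻¹
  have hu0 : 2 * PowerSeries.constantCoeff u = 1 := by
    simpa [hw0, map_ofNat] using congrArg PowerSeries.constantCoeff hu
  -- The quadratic formula gives 2tY as this difference; its zero constant term allows the division
  -- by t.
  have h0 : PowerSeries.constantCoeff (1 - PowerSeries.X * xA - 2 * p * m * u) = 0 := by
    simp [hp, hm, hu0, map_ofNat]
  obtain ⟨Y, hY⟩ := PowerSeries.X_dvd_iff.2 h0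
  have hhalf : (2 : A) * PowerSeries.C (1 / 2) = 1 := by
    rw [← map_ofNat (PowerSeries.C (R := RatFunc ℚ)) 2, ← map_mul]
    norm_num
  set c : A := PowerSeries.C (1 / 2)
  have hr : 1 - PowerSeries.X * xA - 2 * PowerSeries.X * (c * Y) = 2 * p * m * u := by
    linear_combination hY - PowerSeries.X * Y * hhalf
  refine ⟨c * Y, ?_, ?_⟩
  -- The factorization of the discriminant, multiplied by x(2 + W³)², with t eliminated through W =
  -- t(2 + W³).
  · have h1 : xA * ((2 * p * m * u) ^ 2 * (2 + w ^ 3) ^ 2) =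
        (xA * (1 - PowerSeries.X * xA) ^ 2 - 4 * PowerSeries.X ^ 2) * (2 + w ^ 3) ^ 2 := by
      linear_combination 4 * p ^ 2 * m ^ 2 * xA * ((2 + w ^ 3) * u + 1) * hu + xA * m ^ 2 * hp2
        + xA * (4 - xA * w * (w ^ 3 + 4) + xA ^ 2 * w ^ 2) * hm2
        - (4 - xA * w * (w ^ 3 + 4) + xA ^ 2 * w ^ 2) * w ^ 2 * hx
        + (-xA ^ 2 * (2 * (2 + w ^ 3) - w * xA - PowerSeries.X * (2 + w ^ 3) * xA)
          - 4 * (w + PowerSeries.X * (2 + w ^ 3))) * hw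
    have h2 : (2 + w ^ 3 : A) ≠ 0 := left_ne_zero_of_mul_eq_one hu
    rw [← hr, ← mul_assoc] at h1
    have h3 := mul_right_cancel₀ (pow_ne_zero 2 h2) h1
    have h4 : (2 * 2 * PowerSeries.X : A) ≠ 0 :=
      have h5 := left_ne_zero_of_mul_eq_one hhalf
      mul_ne_zero (mul_ne_zero h5 h5) PowerSeries.X_ne_zero
    refine mul_left_cancel₀ h4 ?_
    linear_combination -h3
  · rw [hr]
    linear_combination 2 * p * m * hu

theorem two_ne_zero_powerSeries (k : Type*) [Field k] [CharZero k] :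
    (2 : PowerSeries k) ≠ 0 := by
  rw [← map_ofNat (PowerSeries.C (R := k)) 2, Ne, map_eq_zero_iff _ PowerSeries.C_injective]
  exact two_ne_zero

theorem W_ne_zero (hW : W = PowerSeries.X * (2 + W ^ 3)) : W ≠ 0 := by
  intro h
  have := coeff_W_pow_self hW 1
  norm_num [h] at this

theorem exists_eq_X_mul {F : A} (hF : PowerSeries.constantCoeff F = 0) :
    ∃ G, F = PowerSeries.X * G :=
  PowerSeries.X_dvd_iff.2 hF

theorem constantCoeff_root {Y : A}
    (hY : xA * Y = PowerSeries.X * (xA ^ 2 * Y + xA * Y ^ 2 + 1)) :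
    PowerSeries.constantCoeff Y = 0 := by
  simpa [xA, RatFunc.X_ne_zero] using congrArg PowerSeries.constantCoeff hY

theorem root_ne_zero {Y : A}
    (hY : xA * Y = PowerSeries.X * (xA ^ 2 * Y + xA * Y ^ 2 + 1)) : Y ≠ 0 := by
  rintro rfl
  exact PowerSeries.X_ne_zero (R := RatFunc ℚ) (by simpa using hY.symm)

/-- The two sides have equal squares because of the kernel relation; the lowest t-coefficients
decide the sign. -/
theorem sqrt_deltaPlus_root (hW : W = PowerSeries.X * (2 + W ^ 3)) {Y : A}
    (hY : xA * Y = PowerSeries.X * (xA ^ 2 * Y + xA * Y ^ 2 + 1)) :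
    Y * ((2 * xA ^ 2 - xA * cst W ^ 2 - cst W) * incl (psSqrt (deltaPlus W))) =
      -(xA * ((2 * Y ^ 2 - Y * cst W ^ 2 - cst W) * subY Y (psSqrt (deltaPlus W)))) := by
  have hp : PowerSeries.constantCoeff (incl (psSqrt (deltaPlus W))) = 1 := by
    have := constantCoeff_psSqrt _ (constantCoeff_deltaPlus hW)
    rw [← PowerSeries.coeff_zero_eq_constantCoeff_apply] at this ⊢
    rw [incl, PowerSeries.coeff_map, this, map_one]
  have hs : PowerSeries.constantCoeff (subY Y (psSqrt (deltaPlus W))) = 1 := by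
    rw [constantCoeff_subY (constantCoeff_root hY),
      constantCoeff_psSqrt _ (constantCoeff_deltaPlus hW)]
    simp
  have hp2 : 4 * incl (psSqrt (deltaPlus W)) ^ 2 =
      4 - xA * cst W * (cst W ^ 3 + 4) + xA ^ 2 * cst W ^ 2 := by
    rw [← map_pow, psSqrt_sq _ (constantCoeff_deltaPlus hW)]
    simpa [map_ofNat] using congrArg incl (four_mul_deltaPlus W)
  have hs2 : 4 * subY Y (psSqrt (deltaPlus W)) ^ 2 =
      4 - Y * cst W * (cst W ^ 3 + 4) + Y ^ 2 * cst W ^ 2 := by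
    rw [← map_pow, psSqrt_sq _ (constantCoeff_deltaPlus hW)]
    simpa [map_ofNat] using congrArg (subY Y) (four_mul_deltaPlus W)
  have hw : cst W = PowerSeries.X * (2 + cst W ^ 3) := by
    simpa [map_ofNat] using congrArg cst hW
  have hw0 : PowerSeries.constantCoeff (cst W) = 0 := by
    rw [hw]
    simp
  have hY0 := constantCoeff_root hY
  have hx : PowerSeries.constantCoeff xA ≠ 0 := by simp [xA, RatFunc.X_ne_zero]
  set p := incl (psSqrt (deltaPlus W))
  set s := subY Y (psSqrt (deltaPlus W))
  set w := cst W
  have h4 : (2 * 2 : A) ≠ 0 := mul_ne_zero (two_ne_zero_powerSeries _) (two_ne_zero_powerSeries _)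
  have hsq : (Y * ((2 * xA ^ 2 - xA * w ^ 2 - w) * p)) ^ 2 =
      (xA * ((2 * Y ^ 2 - Y * w ^ 2 - w) * s)) ^ 2 := by
    -- The kernel relation with t eliminated; it is symmetric in x and Y.
    have hk : (2 + w ^ 3) * xA * Y = w + w * xA * Y * (xA + Y) := by
      linear_combination (2 + w ^ 3) * hY - (xA ^ 2 * Y + xA * Y ^ 2 + 1) * hw
    refine mul_left_cancel₀ h4 ?_
    linear_combination Y ^ 2 * (2 * xA ^ 2 - xA * w ^ 2 - w) ^ 2 * hp2
      - xA ^ 2 * (2 * Y ^ 2 - Y * w ^ 2 - w) ^ 2 * hs2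
      + (xA - Y) * (4 * (Y * (w + (2 + w ^ 3) * xA ^ 2 - w * xA ^ 3)
        + xA * (w + (2 + w ^ 3) * Y ^ 2 - w * Y ^ 3)) + (4 * w ^ 2 - w ^ 5) * xA * Y) * hk
  rcases sq_eq_sq_iff_eq_or_eq_neg.1 hsq with h | h
  -- With Y = ty and W = tv, at t = 0 one has xy = 1 and v = 2, and the wrong sign would give 2x =
  -- −2x.
  · exfalso
    obtain ⟨y, rfl⟩ := exists_eq_X_mul hY0
    obtain ⟨v, hv⟩ := exists_eq_X_mul hw0
    have hXne := PowerSeries.X_ne_zero (R := RatFunc ℚ)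
    have hy : xA * y = xA ^ 2 * (PowerSeries.X * y) + xA * (PowerSeries.X * y) ^ 2 + 1 := by
      refine mul_left_cancel₀ hXne ?_
      linear_combination hY
    have hv1 : v = 2 + w ^ 3 := by
      refine mul_left_cancel₀ hXne ?_
      rw [← hv, ← hw]
    have h1 : y * ((2 * xA ^ 2 - xA * w ^ 2 - w) * p) =
        xA * ((2 * PowerSeries.X * y ^ 2 - y * w ^ 2 - v) * s) := by
      refine mul_left_cancel₀ hXne ?_
      linear_combination h - xA * s * hv
    have hv0 : PowerSeries.constantCoeff v = 2 := by simp [hv1, hw0, map_ofNat]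
    have hy0 := congrArg PowerSeries.constantCoeff hy
    have h2 := congrArg PowerSeries.constantCoeff h1
    simp only [map_mul, map_add, map_sub, map_pow, map_ofNat, hw0, hp, hs, hv0,
      PowerSeries.constantCoeff_X, map_one] at hy0 h2
    have h5 : 4 * PowerSeries.constantCoeff xA = 0 := by
      linear_combination h2 - 2 * PowerSeries.constantCoeff xA * hy0
    exact hx (by simpa using h5)
  · exact h


theorem evalZero_psSqrt_deltaPlus (hW : W = PowerSeries.X * (2 + W ^ 3)) :
    evalZero (psSqrt (deltaPlus W)) = 1 := by
  have h1 : evalZero (psSqrt (deltaPlus W)) ^ 2 = 1 ^ 2 := by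
    rw [← map_pow, psSqrt_sq _ (constantCoeff_deltaPlus hW)]
    have h := congrArg evalZero (four_mul_deltaPlus W)
    simp only [map_mul, map_add, map_sub, map_pow, map_ofNat, evalZero_varX, evalZero_constX] at h
    refine mul_left_cancel₀ (mul_ne_zero (two_ne_zero_powerSeries ℚ) (two_ne_zero_powerSeries ℚ)) ?_
    linear_combination h
  rcases sq_eq_sq_iff_eq_or_eq_neg.1 h1 with h | h
  · exact h
  · have h2 := congrArg (PowerSeries.coeff 0) h
    rw [evalZero, PowerSeries.coeff_map, PowerSeries.coeff_zero_eq_constantCoeff_apply,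
      constantCoeff_psSqrt _ (constantCoeff_deltaPlus hW)] at h2
    norm_num at h2

/-- The formulas for `Q(x, 0; t)` and `Q(0, 0; t)`, without denominators. -/
theorem Qx0_formula (hW : W = PowerSeries.X * (2 + W ^ 3)) :
    16 * PowerSeries.X ^ 2 * varX * constX W * Qx0 =
        PowerSeries.X * varX * constX W ^ 2 * (4 - constX W ^ 3)
          - 8 * constX W * (PowerSeries.X - varX ^ 2 + PowerSeries.X * varX ^ 3)
          - 8 * PowerSeries.X * ((2 * varX ^ 2 - varX * constX W ^ 2 - constX W)
            * psSqrt (deltaPlus W)) ∧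
      8 * PowerSeries.X * Q00 = W * (4 - W ^ 3) := by
  -- E = (√Δ₊ − 1)/x absorbs the poles at x = 0 in the claimed formula, so that Y can be substituted
  -- for x.
  obtain ⟨E, hE⟩ := exists_eq_varX_mul (F := psSqrt (deltaPlus W) - 1)
    (by rw [map_sub, evalZero_psSqrt_deltaPlus hW, map_one, sub_self])
  have hE0 : 8 * evalZero E = -(W * (W ^ 3 + 4)) := by
    have h1 : varX * (8 * E + 4 * varX * E ^ 2) =
        varX * (-(constX W * (constX W ^ 3 + 4)) + varX * constX W ^ 2) := by
      have h2 := four_mul_deltaPlus W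
      rw [← psSqrt_sq _ (constantCoeff_deltaPlus hW)] at h2
      linear_combination h2 - 4 * (psSqrt (deltaPlus W) + 1 + varX * E) * hE
    have hx : varX ≠ 0 := by
      rw [varX, Ne, map_eq_zero_iff _ PowerSeries.C_injective]
      exact X_ne_zero
    have h3 := congrArg evalZero (mul_left_cancel₀ hx h1)
    simpa [map_ofNat] using h3
  obtain ⟨Y, hY, -⟩ := exists_root hW
  -- The claimed value of 16t²W·Q(x,0), written without poles.
  let N : PowerSeries ℚ[X] := PowerSeries.X * constX W ^ 2 * (4 - constX W ^ 3)
    + 8 * constX W * varX - 8 * constX W * PowerSeries.X * varX ^ 2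
    - 8 * PowerSeries.X * ((2 * varX - constX W ^ 2) * psSqrt (deltaPlus W) - constX W * E)
  let D : PowerSeries ℚ[X] := 16 * PowerSeries.X ^ 2 * constX W * Qx0 - N
  have hD0 : evalZero D = 16 * PowerSeries.X ^ 2 * W * Q00
      - 2 * PowerSeries.X * W ^ 2 * (4 - W ^ 3) := by
    simp only [D, N, map_mul, map_add, map_sub, map_pow, map_ofNat, evalZero_varX, evalZero_constX,
      evalZero_X, evalZero_Qx0, evalZero_psSqrt_deltaPlus hW]
    linear_combination (-PowerSeries.X * W) * hE0
  -- Here D(x) + D(Y) = D(0) holds with Q(0,0) still unknown; its value then follows from D(0) = 0.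
  have hD : D = 0 := by
    refine eq_zero_of_incl_add_subY (constantCoeff_root hY) ?_
    have hY0 := root_ne_zero hY
    refine mul_left_cancel₀ (mul_ne_zero xA_ne_zero hY0) ?_
    rw [hD0]
    have h1 := kernel_method_Q hY
    have h2 := sqrt_deltaPlus_root hW hY
    have h3 := congrArg incl hE
    have h4 := congrArg (subY Y) hE
    simp only [map_mul, map_sub, map_one, incl_varX, subY_varX] at h3 h4
    simp only [D, N, map_mul, map_add, map_sub, map_pow, map_ofNat, incl_varX, incl_constX,
      incl_X, subY_varX, subY_constX, subY_X, cst_X]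
    linear_combination (-16 * PowerSeries.X * cst W * xA * Y) * h1
      + 8 * PowerSeries.X * cst W * Y * h3 + 8 * PowerSeries.X * cst W * xA * h4
      + 8 * PowerSeries.X * h2 - 8 * cst W * (xA + Y) * hY
  constructor
  · simp only [D, N] at hD
    linear_combination varX * hD - 8 * PowerSeries.X * constX W * hE
  · rw [hD, map_zero] at hD0
    refine mul_left_cancel₀ (mul_ne_zero (mul_ne_zero (two_ne_zero_powerSeries ℚ)
      PowerSeries.X_ne_zero) (W_ne_zero hW)) ?_
    linear_combination -hD0

/-- The formula for the generating function of the walks that end on the diagonal, without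
denominators. -/
theorem Qd_formula (hW : W = PowerSeries.X * (2 + W ^ 3)) :
    2 * PowerSeries.X * varX ^ 2 * psSqrt (deltaMinus W) * Qd =
      varX * constX W * (varX + constX W) - 2 + 2 * psSqrt (deltaMinus W) := by
  obtain ⟨Y, hY, hr⟩ := exists_root hW
  have hY0 := root_ne_zero hY
  have hx := xA_mul_xbarA
  have hV := kernel_method_V hY
  have hQ := kernel_method_Q hY
  have hd := congrArg invX diagonal_equation
  have hvarX : (PowerSeries.C X : PowerSeries ℚ[X]) = varX := rfl
  rw [map_pow, hvarX] at hd
  simp only [map_mul, map_add, map_sub, map_pow, map_ofNat, invX_varX, invX_constX, invX_X] at hd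
  have hF := congrArg incl (Qx0_formula hW).1
  have h0 := congrArg cst (Qx0_formula hW).2
  simp only [map_mul, map_add, map_sub, map_pow, map_ofNat, incl_varX, incl_constX, incl_X,
    cst_X] at hF h0
  have hw : cst W = PowerSeries.X * (2 + cst W ^ 3) := by
    simpa [map_ofNat] using congrArg cst hW
  -- The identity is proved at 1/x, where both kernel equations share the root Y.
  refine invX_injective ?_
  simp only [map_mul, map_add, map_sub, map_pow, map_ofNat, invX_varX, invX_constX, invX_X]
  have hp0 : incl (psSqrt (deltaPlus W)) ≠ 0 := by
    intro h
    have h1 := (map_eq_zero_iff _ incl_injective).1 h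
    have h2 := constantCoeff_psSqrt _ (constantCoeff_deltaPlus hW)
    rw [h1] at h2
    simp at h2
  have hw0 : cst W ≠ 0 :=
    (map_ne_zero_iff _ (PowerSeries.map_injective _ (algebraMap ℚ (RatFunc ℚ)).injective)).2
      (W_ne_zero hW)
  have hX0 : (PowerSeries.X : A) ≠ 0 := PowerSeries.X_ne_zero
  have h2 := two_ne_zero_powerSeries (RatFunc ℚ)
  set p := incl (psSqrt (deltaPlus W))
  set m := invX (psSqrt (deltaMinus W))
  set w := cst W
  set D := invX Qd
  set R := subY Y Qx0
  set z := xbarA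
  set v := invX V1
  have hV' : xA * Y = PowerSeries.X * (D + xA ^ 2 * Y * R - Y * v) := by
    linear_combination xA ^ 2 * hV +
      (PowerSeries.X * (xA * z + 1) * (D - Y * v) - xA * Y) * hx
  have hd' : xA * D = xA + PowerSeries.X * (2 * v + xA ^ 2 * D - xA ^ 2 * cst Q00) := by
    linear_combination xA ^ 2 * hd + (PowerSeries.X * (xA * z + 1) * 2 * v - xA * D + xA) * hx
  -- Elimination of `V1` between the equation at Y and the diagonal equation.
  have h3 : D * (1 - PowerSeries.X * xA - 2 * PowerSeries.X * Y) =
      1 - 2 * PowerSeries.X * xA * R + PowerSeries.X * xA * cst Q00 := by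
    refine mul_left_cancel₀ (mul_ne_zero xA_ne_zero hY0) ?_
    linear_combination 2 * D * hY - Y * hd' - 2 * hV'
  have h5 : 8 * PowerSeries.X * w * D * (1 - PowerSeries.X * xA - 2 * PowerSeries.X * Y) =
      8 * w * xA ^ 2 * (1 - PowerSeries.X * xA - 2 * PowerSeries.X * Y)
        - 8 * PowerSeries.X * ((2 * xA ^ 2 - xA * w ^ 2 - w) * p) := by
    linear_combination 8 * PowerSeries.X * w * h3 + 16 * PowerSeries.X * w * xA * hQ + hF
      - PowerSeries.X * w * xA * h0
  -- Inserting the factored form of 1 − tx − 2tY makes √Δ₊(x) a common factor, which is cancelled.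
  have h4 : 2 * PowerSeries.X * D * m = 2 * xA ^ 2 * m - (2 * xA ^ 2 - xA * w ^ 2 - w) := by
    refine mul_left_cancel₀ (mul_ne_zero (mul_ne_zero (mul_ne_zero h2 (mul_ne_zero h2 h2)) hw0)
      hp0) ?_
    linear_combination (2 + w ^ 3) * h5 - (8 * PowerSeries.X * w * D - 8 * w * xA ^ 2) * hr
      + 8 * (2 * xA ^ 2 - xA * w ^ 2 - w) * p * hw
  linear_combination z ^ 2 * h4 + (2 * (m - 1) * (xA * z + 1) + z * w ^ 2) * hx


end

/-! ### Extraction of coefficients -/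

/-- Power series in `t` over `ℚ[x]`, seen as power series in `x` over `ℚ[[t]]`. -/
def swapVars : PowerSeries ℚ[X] →+* PowerSeries (PowerSeries ℚ) where
  toFun F := PowerSeries.mk fun i => coeffX i F
  map_one' := by
    ext i n
    simp only [PowerSeries.coeff_mk, coeffX, PowerSeries.coeff_one]
    split_ifs <;> simp_all [coeff_one, PowerSeries.coeff_one]
  map_zero' := by
    ext i n
    simp [coeffX]
  map_add' F G := by
    ext i n
    simp [coeffX]
  map_mul' F G := by
    ext i n
    simp only [PowerSeries.coeff_mk, coeffX, PowerSeries.coeff_mul, finsetSum_coeff, coeff_mul,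
      map_sum]
    exact Finset.sum_comm

theorem coeff_swapVars (i : ℕ) (F : PowerSeries ℚ[X]) :
    PowerSeries.coeff i (swapVars F) = coeffX i F := by
  simp [swapVars]

@[simp]
theorem swapVars_varX : swapVars varX = PowerSeries.X := by
  ext i n
  rw [coeff_swapVars, coeffX, PowerSeries.coeff_mk, varX, PowerSeries.coeff_C,
    PowerSeries.coeff_X]
  split_ifs <;> simp_all [coeff_X, PowerSeries.coeff_one, eq_comm]

@[simp]
theorem swapVars_constX (F : PowerSeries ℚ) : swapVars (constX F) = PowerSeries.C F := by
  ext i n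
  rw [coeff_swapVars, coeffX, PowerSeries.coeff_mk, coeff_constX, PowerSeries.coeff_C]
  split_ifs <;> simp

@[simp]
theorem swapVars_X : swapVars PowerSeries.X = PowerSeries.C PowerSeries.X := by
  rw [← constX_X, swapVars_constX]

/-- `1 / √(1 - X)`. -/
def invSqrtSeries : PowerSeries ℚ := PowerSeries.mk fun i => (i.centralBinom : ℚ) / 4 ^ i

/-- The recursion of the central binomials says 2(1 − X)f′ = f, hence f²(1 − X) has derivative zero.
-/
theorem invSqrtSeries_sq : invSqrtSeries ^ 2 * (1 - PowerSeries.X) = 1 := by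
  have h1 : 2 * (1 - PowerSeries.X) * PowerSeries.derivative ℚ invSqrtSeries = invSqrtSeries := by
    ext n
    have h : (2 * (1 - PowerSeries.X) * PowerSeries.derivative ℚ invSqrtSeries) =
        PowerSeries.C 2 * (PowerSeries.derivative ℚ invSqrtSeries
          - PowerSeries.X * PowerSeries.derivative ℚ invSqrtSeries) := by
      rw [map_ofNat]
      ring
    rw [h, PowerSeries.coeff_C_mul, map_sub, PowerSeries.coeff_derivative]
    have hc : ((n : ℚ) + 1) * (n + 1).centralBinom = 2 * (2 * n + 1) * n.centralBinom := by
      exact_mod_cast Nat.succ_mul_centralBinom_succ n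
    rcases n with _ | n
    · simp [invSqrtSeries]
      norm_num [Nat.centralBinom]
    · rw [PowerSeries.coeff_succ_X_mul, PowerSeries.coeff_derivative]
      simp only [invSqrtSeries, PowerSeries.coeff_mk]
      push_cast at hc ⊢
      field_simp
      linear_combination 8 * 4 ^ n * hc
  refine PowerSeries.derivative.ext ?_ ?_
  · rw [Derivation.leibniz, Derivation.leibniz_pow]
    simp only [map_sub, Derivation.map_one_eq_zero, PowerSeries.derivative_X, smul_eq_mul,
      nsmul_eq_mul]
    push_cast
    linear_combination invSqrtSeries * h1
  · simp [invSqrtSeries]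

/-- `1 / √(1 - x W²)`, as a power series in `x`. -/
def invSqrtDeltaMinus (W : PowerSeries ℚ) : PowerSeries (PowerSeries ℚ) :=
  PowerSeries.rescale (W ^ 2) (PowerSeries.map PowerSeries.C invSqrtSeries)

theorem coeff_invSqrtDeltaMinus (W : PowerSeries ℚ) (i : ℕ) :
    4 ^ i * PowerSeries.coeff i (invSqrtDeltaMinus W) = i.centralBinom * W ^ (2 * i) := by
  have h : (4 : PowerSeries ℚ) ^ i * PowerSeries.C ((i.centralBinom : ℚ) / 4 ^ i) =
      i.centralBinom := by
    rw [← map_ofNat (PowerSeries.C (R := ℚ)) 4, ← map_pow, ← map_mul,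
      mul_div_cancel₀ _ (by positivity), map_natCast]
  rw [invSqrtDeltaMinus, PowerSeries.coeff_rescale, PowerSeries.coeff_map, invSqrtSeries,
    PowerSeries.coeff_mk, ← h]
  ring

/-- This matches the t-adic square root with the x-adic binomial expansion: the product squares to
1, and its constant term excludes −1. -/
theorem swapVars_psSqrt_deltaMinus {W : PowerSeries ℚ} (hW : W = PowerSeries.X * (2 + W ^ 3)) :
    swapVars (psSqrt (deltaMinus W)) * invSqrtDeltaMinus W = 1 := by
  have h1 : invSqrtDeltaMinus W ^ 2 * (1 - PowerSeries.C (W ^ 2) * PowerSeries.X) = 1 := by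
    have h := congrArg (fun F => PowerSeries.rescale (W ^ 2)
      (PowerSeries.map (PowerSeries.C (R := ℚ)) F)) invSqrtSeries_sq
    simpa [invSqrtDeltaMinus, PowerSeries.rescale_X] using h
  have h2 : swapVars (psSqrt (deltaMinus W)) ^ 2 = 1 - PowerSeries.C (W ^ 2) * PowerSeries.X := by
    rw [← map_pow, psSqrt_sq _ (constantCoeff_deltaMinus hW)]
    simp [deltaMinus, mul_comm]
  have h3 : (swapVars (psSqrt (deltaMinus W)) * invSqrtDeltaMinus W) ^ 2 = 1 ^ 2 := by
    rw [mul_pow, h2, mul_comm, h1, one_pow]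
  rcases sq_eq_sq_iff_eq_or_eq_neg.1 h3 with h | h
  · exact h
  · exfalso
    have h4 : PowerSeries.constantCoeff (PowerSeries.constantCoeff
        (swapVars (psSqrt (deltaMinus W)))) = 1 := by
      rw [← PowerSeries.coeff_zero_eq_constantCoeff_apply,
        ← PowerSeries.coeff_zero_eq_constantCoeff_apply, coeff_swapVars, coeffX,
        PowerSeries.coeff_mk, PowerSeries.coeff_zero_eq_constantCoeff_apply,
        constantCoeff_psSqrt _ (constantCoeff_deltaMinus hW), coeff_one_zero]
    have h5 : PowerSeries.constantCoeff (invSqrtDeltaMinus W) = 1 := by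
      simpa using coeff_invSqrtDeltaMinus W 0
    have h6 := congrArg (fun F => PowerSeries.constantCoeff (PowerSeries.constantCoeff F)) h
    simp only [map_mul, map_neg, map_one, h4, h5] at h6
    norm_num at h6

/-- The coefficient of x^(i+2) in `Qd_formula` divided by √Δ₋ involves three consecutive central
binomials, which reduce to one. -/
theorem coeffX_Qd {W : PowerSeries ℚ} (hW : W = PowerSeries.X * (2 + W ^ 3)) (i : ℕ) :
    4 ^ (i + 1) * ((i : PowerSeries ℚ) + 2) * (PowerSeries.X * coeffX i Qd) =
      W ^ (2 * i + 1) * (i.centralBinom : PowerSeries ℚ) *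
        (2 * (i : PowerSeries ℚ) + 4 - (2 * (i : PowerSeries ℚ) + 1) * W ^ 3) := by
  have h1 := congrArg swapVars (Qd_formula hW)
  simp only [map_mul, map_add, map_sub, map_pow, map_ofNat, swapVars_varX, swapVars_constX,
    swapVars_X] at h1
  have h2 := swapVars_psSqrt_deltaMinus hW
  set m := swapVars (psSqrt (deltaMinus W))
  set g := invSqrtDeltaMinus W
  have h3 : PowerSeries.X ^ 2 * (PowerSeries.C (2 * PowerSeries.X) * swapVars Qd) =
      PowerSeries.X ^ 2 * (PowerSeries.C W * g) + PowerSeries.X * (PowerSeries.C (W ^ 2) * g)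
        - PowerSeries.C 2 * g + PowerSeries.C 2 := by
    simp only [map_mul, map_pow, map_ofNat]
    linear_combination g * h1
      - (2 * PowerSeries.C PowerSeries.X * PowerSeries.X ^ 2 * swapVars Qd - 2) * h2
  have h4 := congrArg (PowerSeries.coeff (i + 2)) h3
  rw [map_add, map_sub, map_add] at h4
  rw [PowerSeries.coeff_X_pow_mul, PowerSeries.coeff_X_pow_mul,
    show i + 2 = i + 1 + 1 from rfl, PowerSeries.coeff_succ_X_mul, PowerSeries.coeff_C_mul,
    PowerSeries.coeff_C_mul, PowerSeries.coeff_C_mul, PowerSeries.coeff_C_mul,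
    PowerSeries.coeff_succ_C, coeff_swapVars] at h4
  have e0 := coeff_invSqrtDeltaMinus W i
  have e1 := coeff_invSqrtDeltaMinus W (i + 1)
  have e2 := coeff_invSqrtDeltaMinus W (i + 1 + 1)
  have : CharZero (PowerSeries ℚ) := algebraRat.charZero _
  have c1 : ((i : PowerSeries ℚ) + 1) * ((i + 1).centralBinom : PowerSeries ℚ) =
      2 * (2 * i + 1) * (i.centralBinom : PowerSeries ℚ) := by
    exact_mod_cast Nat.succ_mul_centralBinom_succ i
  have c2 : ((i : PowerSeries ℚ) + 2) * ((i + 1 + 1).centralBinom : PowerSeries ℚ) =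
      2 * (2 * i + 3) * ((i + 1).centralBinom : PowerSeries ℚ) := by
    have h := Nat.succ_mul_centralBinom_succ (i + 1)
    rw [show 2 * (i + 1) + 1 = 2 * i + 3 by ring] at h
    exact_mod_cast h
  have h5 : (8 * ((i : PowerSeries ℚ) + 1)) ≠ 0 := by
    exact_mod_cast (by positivity : 8 * (i + 1) ≠ 0)
  refine mul_left_cancel₀ h5 ?_
  linear_combination 4 ^ (i + 2) * ((i : PowerSeries ℚ) + 1) * (i + 2) * h4
    + ((i : PowerSeries ℚ) + 1) * (i + 2) * (16 * W * e0 + 4 * W ^ 2 * e1 - 2 * e2)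
    - 2 * ((i : PowerSeries ℚ) + 1) * W ^ (2 * i + 4) * c2
    - 4 * ((i : PowerSeries ℚ) + 1) * W ^ (2 * i + 4) * c1

theorem coeff_coeffX_Qd (i n : ℕ) : PowerSeries.coeff n (coeffX i Qd) = (q i i n : ℚ) := by
  rw [coeffX, PowerSeries.coeff_mk, coeff_Qd]

/-- The coefficient of t^(n+1) in `coeffX_Qd`, where n + 1 = (2i+1) + 3m = (2i+4) + 3(m−1): Lagrange
inversion applies to both powers of W. -/
theorem q_diagonal (i m : ℕ) :
    (q i i (3 * m + 2 * i) : ℚ) =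
      4 ^ m * ((i : ℚ) + 1) ^ 2 / (((m : ℚ) + i + 1) * (2 * (m : ℚ) + 2 * i + 1))
        * (Nat.choose (2 * i + 1) i : ℚ) * (Nat.choose (3 * m + 2 * i) m : ℚ) := by
  obtain ⟨W, hW, -⟩ := existsUnique_W
  have h1 : 4 ^ (i + 1) * ((i : ℚ) + 2) * q i i (3 * m + 2 * i) =
      i.centralBinom * ((2 * i + 4) * PowerSeries.coeff (2 * i + 1 + 3 * m) (W ^ (2 * i + 1))
        - (2 * i + 1) * PowerSeries.coeff (2 * i + 1 + 3 * m) (W ^ (2 * i + 4))) := by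
    have h : PowerSeries.C (4 ^ (i + 1) * ((i : ℚ) + 2)) * (PowerSeries.X * coeffX i Qd) =
        PowerSeries.C (i.centralBinom : ℚ) * (PowerSeries.C (2 * (i : ℚ) + 4) * W ^ (2 * i + 1)
          - PowerSeries.C (2 * (i : ℚ) + 1) * W ^ (2 * i + 4)) := by
      simp only [map_mul, map_add, map_pow, map_ofNat, map_natCast, map_one]
      linear_combination coeffX_Qd hW i
    have h' := congrArg (PowerSeries.coeff (3 * m + 2 * i + 1)) h
    rw [PowerSeries.coeff_C_mul, PowerSeries.coeff_succ_X_mul, coeff_coeffX_Qd,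
      PowerSeries.coeff_C_mul, map_sub, PowerSeries.coeff_C_mul, PowerSeries.coeff_C_mul,
      show 3 * m + 2 * i + 1 = 2 * i + 1 + 3 * m by ring] at h'
    exact h'
  have h2 := coeff_W_pow hW m (2 * i + 1)
  have h3 : (2 * i + 1 + 3 * m : ℚ) * ((m : ℚ) + i + 1) *
      PowerSeries.coeff (2 * i + 1 + 3 * m) (W ^ (2 * i + 4)) =
        (2 * i + 4) * 2 ^ (2 * i + 1 + 2 * m) * m * (2 * i + 1 + 3 * m).choose m := by
    -- For m = 0 the power W^(2i+4) has too high an order in t to contribute.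
    rcases m with _ | m
    · rw [coeff_W_pow_of_lt hW (by omega)]
      simp
    · have h4 := coeff_W_pow hW m (2 * i + 4)
      rw [show 2 * i + 4 + 3 * m = 2 * i + 1 + 3 * (m + 1) by ring] at h4
      have h5 : ((2 * i + 1 + 3 * (m + 1)).choose (m + 1) : ℚ) * (m + 1) =
          (2 * i + 1 + 3 * (m + 1)).choose m * (2 * (m + i + 2)) := by
        have := Nat.choose_succ_right_eq (2 * i + 1 + 3 * (m + 1)) m
        rw [show 2 * i + 1 + 3 * (m + 1) - m = 2 * (m + i + 2) by omega] at this
        exact_mod_cast this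
      push_cast at h4 ⊢
      linear_combination (m + i + 2 : ℚ) * h4
        - (2 * i + 4) * 2 ^ (2 * i + 1 + 2 * (m + 1)) * h5
  have h4 : ((2 * i + 1 + 3 * m).choose m : ℚ) * (2 * m + 2 * i + 1) =
      (2 * i + 1 + 3 * m) * (3 * m + 2 * i).choose m := by
    have := Nat.choose_mul_succ_eq (3 * m + 2 * i) m
    rw [show 3 * m + 2 * i + 1 - m = 2 * m + 2 * i + 1 by omega,
      show 3 * m + 2 * i + 1 = 2 * i + 1 + 3 * m by ring] at this
    rw [mul_comm (2 * i + 1 + 3 * m : ℚ)]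
    exact_mod_cast this.symm
  have h5 : ((2 * i + 1).choose i : ℚ) * (i + 1) = (2 * i + 1) * i.centralBinom := by
    have := Nat.choose_mul_succ_eq (2 * i) i
    rw [show 2 * i + 1 - i = i + 1 by omega] at this
    rw [Nat.centralBinom, mul_comm (2 * i + 1 : ℚ)]
    exact_mod_cast this.symm
  have h6 : (2 : ℚ) ^ (2 * i + 1 + 2 * m) = 2 * 4 ^ i * 4 ^ m := by
    rw [pow_add, pow_add, pow_mul, pow_mul]
    norm_num
    ring
  rw [h6] at h2 h3
  push_cast at h2
  have h7 : (q i i (3 * m + 2 * i) : ℚ) * (((m : ℚ) + i + 1) * (2 * m + 2 * i + 1)) =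
      4 ^ m * ((i : ℚ) + 1) ^ 2 * (2 * i + 1).choose i * (3 * m + 2 * i).choose m := by
    have h8 : (4 ^ (i + 1) * ((i : ℚ) + 2) * (2 * i + 1 + 3 * m)) ≠ 0 := by positivity
    refine mul_left_cancel₀ h8 ?_
    linear_combination ((m : ℚ) + i + 1) * (2 * m + 2 * i + 1) * (2 * i + 1 + 3 * m) * h1
      + (2 * m + 2 * i + 1) * i.centralBinom * ((2 * i + 4) * ((m : ℚ) + i + 1) * h2
        - (2 * i + 1) * h3)
      - 4 ^ (i + 1) * ((i : ℚ) + 2) * (2 * i + 1 + 3 * m) * 4 ^ m * (i + 1)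
        * (3 * m + 2 * i).choose m * h5
      + 4 ^ (i + 1) * ((i : ℚ) + 2) * 4 ^ m * (i + 1) * (2 * i + 1) * i.centralBinom * h4
  rw [div_mul_eq_mul_div, div_mul_eq_mul_div, eq_div_iff (by positivity), h7]

/-! ### Passage to Laurent series, where the denominators can be restored -/

theorem toK_injective : Function.Injective toK := by
  rw [toK, RingHom.coe_comp]
  exact HahnSeries.ofPowerSeries_injective.comp
    (PowerSeries.map_injective _ (IsFractionRing.injective ℚ[X] (RatFunc ℚ)))

theorem seriesK_injective : Function.Injective seriesK := by
  rw [seriesK, RingHom.coe_comp]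
  exact toK_injective.comp (PowerSeries.map_injective _ C_injective)

theorem toLaurent_injective : Function.Injective toLaurent := HahnSeries.ofPowerSeries_injective

theorem toK_constX (F : PowerSeries ℚ) : toK (constX F) = seriesK F := rfl

theorem toK_varX : toK varX = xK := rfl

theorem toK_X : toK PowerSeries.X = tK := rfl

theorem xK_ne_zero : xK ≠ 0 := by
  rw [← toK_varX, map_ne_zero_iff _ toK_injective, varX,
    map_ne_zero_iff _ PowerSeries.C_injective]
  exact X_ne_zero

theorem tK_ne_zero : tK ≠ 0 := (map_ne_zero_iff _ toK_injective).2 PowerSeries.X_ne_zero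

theorem charZero_laurentSeries (k : Type*) [Field k] [CharZero k] : CharZero (LaurentSeries k) :=
  charZero_of_injective_algebraMap (algebraMap k (LaurentSeries k)).injective

theorem toK_Qx0 {W : PowerSeries ℚ} (hW : W = PowerSeries.X * (2 + W ^ 3)) :
    toK Qx0 =
      seriesK W * (4 - seriesK W ^ 3) / (16 * tK)
        - (tK - xK ^ 2 + tK * xK ^ 3) / (2 * xK * tK ^ 2)
        - (2 * xK ^ 2 - xK * seriesK W ^ 2 - seriesK W) * toK (psSqrt (deltaPlus W))
            / (2 * tK * xK * seriesK W) := by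
  have h := congrArg toK (Qx0_formula hW).1
  simp only [map_mul, map_add, map_sub, map_pow, map_ofNat, toK_constX, toK_varX, toK_X] at h
  have hw : seriesK W ≠ 0 := (map_ne_zero_iff _ seriesK_injective).2 (W_ne_zero hW)
  have hx := xK_ne_zero
  have ht := tK_ne_zero
  have := charZero_laurentSeries (RatFunc ℚ)
  generalize seriesK W = w at *
  generalize toK (psSqrt (deltaPlus W)) = p at *
  generalize toK Qx0 = F at *
  generalize xK = x at *
  generalize tK = t at *
  field_simp
  linear_combination 2 * h

theorem toK_Qd {W : PowerSeries ℚ} (hW : W = PowerSeries.X * (2 + W ^ 3)) :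
    toK Qd =
      (xK * seriesK W * (xK + seriesK W) - 2)
          / (2 * tK * xK ^ 2 * toK (psSqrt (deltaMinus W)))
        + 1 / (tK * xK ^ 2) := by
  have h := congrArg toK (Qd_formula hW)
  simp only [map_mul, map_add, map_sub, map_pow, map_ofNat, toK_constX, toK_varX, toK_X] at h
  have hm : toK (psSqrt (deltaMinus W)) ≠ 0 := by
    rw [map_ne_zero_iff _ toK_injective]
    intro h0
    have h1 := constantCoeff_psSqrt _ (constantCoeff_deltaMinus hW)
    simp [h0] at h1
  have hx := xK_ne_zero
  have ht := tK_ne_zero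
  have := charZero_laurentSeries (RatFunc ℚ)
  generalize seriesK W = w at *
  generalize toK (psSqrt (deltaMinus W)) = p at *
  generalize toK Qd = F at *
  generalize xK = x at *
  generalize tK = t at *
  field_simp
  linear_combination h

theorem toLaurent_coeffX_Qd {W : PowerSeries ℚ} (hW : W = PowerSeries.X * (2 + W ^ 3)) (i : ℕ) :
    toLaurent (coeffX i Qd) =
      toLaurent W ^ (2 * i + 1)
          / (4 ^ (i + 1) * toLaurent PowerSeries.X * ((i : LaurentSeries ℚ) + 2))
        * (Nat.choose (2 * i) i : LaurentSeries ℚ)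
        * (2 * (i : LaurentSeries ℚ) + 4
            - (2 * (i : LaurentSeries ℚ) + 1) * toLaurent W ^ 3) := by
  have h := congrArg toLaurent (coeffX_Qd hW i)
  simp only [map_mul, map_add, map_sub, map_pow, map_ofNat, map_natCast, map_one,
    Nat.centralBinom] at h
  have ht : toLaurent PowerSeries.X ≠ 0 :=
    (map_ne_zero_iff _ toLaurent_injective).2 PowerSeries.X_ne_zero
  have := charZero_laurentSeries ℚ
  have hi : (i : LaurentSeries ℚ) + 2 ≠ 0 := by exact_mod_cast (i + 1).succ_ne_zero
  rw [div_mul_eq_mul_div, div_mul_eq_mul_div, eq_div_iff (by simp [ht, hi])]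
  linear_combination h

end ReverseKreweras

end

theorem mainTheorem8 :
    -- `W` is well defined
    (∃! W : PowerSeries ℚ, W = PowerSeries.X * (2 + W ^ 3)) ∧
    (∀ W : PowerSeries ℚ, W = PowerSeries.X * (2 + W ^ 3) →
      -- the formula for `Q(x, 0; t)`, in `ℚ(x)((t))`
      (toK Qx0 =
        seriesK W * (4 - seriesK W ^ 3) / (16 * tK)
          - (tK - xK ^ 2 + tK * xK ^ 3) / (2 * xK * tK ^ 2)
          - (2 * xK ^ 2 - xK * seriesK W ^ 2 - seriesK W) * toK (psSqrt (deltaPlus W))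
              / (2 * tK * xK * seriesK W)) ∧
      -- the formula for `Q_d(x; t)`, in `ℚ(x)((t))`
      (toK Qd =
        (xK * seriesK W * (xK + seriesK W) - 2)
            / (2 * tK * xK ^ 2 * toK (psSqrt (deltaMinus W)))
          + 1 / (tK * xK ^ 2)) ∧
      -- the formula for `[x^i] Q_d(x; t)`, in `ℚ((t))`
      (∀ i : ℕ, toLaurent (coeffX i Qd) =
        toLaurent W ^ (2 * i + 1)
            / (4 ^ (i + 1) * toLaurent PowerSeries.X * ((i : LaurentSeries ℚ) + 2))
          * (Nat.choose (2 * i) i : LaurentSeries ℚ)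
          * (2 * (i : LaurentSeries ℚ) + 4
              - (2 * (i : LaurentSeries ℚ) + 1) * toLaurent W ^ 3))) ∧
    -- the number of walks of length `3m + 2i` that end at `(i, i)`
    (∀ i m : ℕ,
      (q i i (3 * m + 2 * i) : ℚ) =
        4 ^ m * ((i : ℚ) + 1) ^ 2 / (((m : ℚ) + i + 1) * (2 * (m : ℚ) + 2 * i + 1))
          * (Nat.choose (2 * i + 1) i : ℚ) * (Nat.choose (3 * m + 2 * i) m : ℚ)) := by
  exact ⟨existsUnique_W, fun W hW => ⟨toK_Qx0 hW, toK_Qd hW, toLaurent_coeffX_Qd hW⟩, q_diagonal⟩
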